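/- All rings are associative with $1\neq 0$, not necessarily commutative. A group is called indecomposable if it is not isomorphic to a direct product of two non-trivial groups (so the trivial group is indecomposable). $C_n$ denotes the cyclic group of order $n$, and $C_{p^\infty}=\bigcup_{n\ge 0}C_{p^n}$ the quasi-cyclic $p$-group. A Fermat prime is a prime of the form $2^{2^m}+1$ with $m\ge 0$; a Mersenne prime is a prime of the form $2^k-1$. $\mathbf F_r$ is the field with $r$ elements and $\mathbb Z_n=\mathbb Z/n\mathbb Z$. **Theorem.** Let $R$ be a unital ring. If the group of units $R^\times$ is an indecomposable abelian group, then $\operatorname{char} R\in\{0,2,4,q,2q\}$ for some Fermat prime $q$. For each such characteristic $c$, the following is, up to isomorphism, the complete list of the indecomposable abelian groups that occur as $R^\times$ for a ring $R$ with $\operatorname{char}R=c$; in brackets is a ring of characteristic $c$ with that unit group. - $c=0$: $C_2$ $[\mathbb Z]$; $C_4$ $[\mathbb Z[i]]$. - $c=2$: $C_1$ $[\mathbf F_2]$; $C_2$ $[\mathbf F_2[x]/(x^2)]$; $C_4$ $[\mathbf F_2[x]/(x^3)]$; $C_p$ for every Mersenne prime $p$ $[\mathbf F_{p+1}]$; every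 indecomposable torsion-free abelian group $G$ $[$the group algebra $\mathbf F_2[G]]$. - $c=4$: $C_2$ $[\mathbb Z_4]$; $C_4$ $[\mathbb Z_4[x]/(x^2-2,2x)]$. - $c=3$: $C_2$ $[\mathbf F_3]$; $C_8$ $[\mathbf F_9]$. - $c=6$: $C_2$ $[\mathbf F_3\times\mathbf F_2]$; $C_8$ $[\mathbf F_9\times\mathbf F_2]$. - $c=q$, with $q>3$ a Fermat prime: $C_{q-1}$ $[\mathbf F_q]$. - $c=2q$, with $q>3$ a Fermat prime: $C_{q-1}$ $[\mathbf F_q\times\mathbf F_2]$. In particular, for every prime $p$ there is no ring $R$ with $R^\times\cong C_{p^\infty}$. -/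

import Mathlib

open Polynomial

universe u

namespace FuchsIndecomposable

/-- A group is indecomposable if it is not isomorphic to the direct product of two non-trivial
groups. The trivial group is indecomposable in this sense. (Each factor embeds in `G`, so
factors in the universe of `G` suffice.) -/
def IsIndecomposable (G : Type u) [Group G] : Prop :=
  ∀ (A B : Type u) [Group A] [Group B], Nonempty (G ≃* A × B) → Subsingleton A ∨ Subsingleton B

/-- The cyclic group `C_n` of order `n`, for `n ≥ 1`. -/
abbrev CyclicGroup (n : ℕ) : Type := Multiplicative (ZMod n)

/-- `G` is isomorphic to `C_n`. -/
def IsoCyclic (G : Type u) [Group G] (n : ℕ) : Prop := Nonempty (G ≃* CyclicGroup n)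

/-- The quasi-cyclic group `C_{p^∞}`: the union over `n ≥ 0` of the groups of complex
`p^n`-th roots of unity. -/
def quasiCyclic (p : ℕ) : Subgroup ℂˣ where
  carrier := {z | ∃ n : ℕ, z ∈ rootsOfUnity (p ^ n) ℂ}
  one_mem' := ⟨0, one_mem _⟩
  mul_mem' := by
    rintro a b ⟨m, hm⟩ ⟨n, hn⟩
    exact ⟨m + n, mul_mem (rootsOfUnity_le_of_dvd (pow_dvd_pow p (Nat.le_add_right m n)) hm)
      (rootsOfUnity_le_of_dvd (pow_dvd_pow p (Nat.le_add_left n m)) hn)⟩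
  inv_mem' := by
    rintro a ⟨n, hn⟩
    exact ⟨n, inv_mem hn⟩

/-- `q` is a Fermat prime: a prime of the form `2 ^ 2 ^ m + 1`. -/
def IsFermatPrime (q : ℕ) : Prop := q.Prime ∧ ∃ m : ℕ, q = Nat.fermatNumber m

/-- `p` is a Mersenne prime: a prime of the form `2 ^ k - 1`. -/
def IsMersennePrime (p : ℕ) : Prop := p.Prime ∧ ∃ k : ℕ, p = mersenne k

/-- The ring `R` has characteristic `c`, and its group of units is isomorphic to `G`. -/
def HasCharAndUnits (R : Type*) [Ring R] (c : ℕ) (G : Type*) [Group G] : Prop :=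
  CharP R c ∧ Nonempty (Rˣ ≃* G)

/-- `G` is the group of units of a nonzero, not necessarily commutative, unital ring of
characteristic `c`. -/
def IsUnitGroupInChar (c : ℕ) (G : Type u) [Group G] : Prop :=
  ∃ (R : Type u) (_ : Ring R), Nontrivial R ∧ HasCharAndUnits R c G

end FuchsIndecomposable

open FuchsIndecomposable

/-! The subring generated by the units has the same units and is commutative when they commute, so
`R` may be assumed commutative. If the unit group is torsion-free, then `-1 = 1` and the
characteristic is 2; conversely, over `ZMod 2` the group algebra of a torsion-free abelian group has
only the group elements as units. Otherwise some unit has prime order `p`. A cyclic or quasi-cyclic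
`p`-subgroup then splits off, and indecomposability makes it the whole group
(`IsIndecomposable.isLocallyCyclicPGroup`).

Outside characteristic 2 the unit `-1` has order 2, so `p = 2` and the only square roots of 1 in `R`
are `1` and `-1`. Testing this on the images of integers, together with a lifted primitive root
modulo `q`, leaves only the characteristics 0, 4, `q` and `2 * q` with `q` a Fermat prime
(`char_eq_of_isLocallyCyclicPGroup`).

It remains to bound the exponent, which makes the group cyclic and excludes quasi-cyclic groups. In
characteristics 0 and 4, and in characteristic 2 with `p = 2`, a unit of order 8 produces a unit of
infinite order, a forbidden square root of 1 or a forbidden square-zero element, so `u ^ 4 = 1`. In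
the remaining cases `R` is reduced and each unit lies in a finite product of finite fields with `p ^
a + 1` elements (`units_pow_eq_one_of_isReduced`); the equation `r ^ d = p ^ a + 1` then yields the
exponent. -/

/-- A `p`-group any two elements of which lie in a common cyclic subgroup. -/
def IsLocallyCyclicPGroup (p : ℕ) (G : Type*) [Group G] : Prop :=
  IsPGroup p G ∧ ∀ a b : G, ∃ c : G, a ∈ Subgroup.zpowers c ∧ b ∈ Subgroup.zpowers c

/-! ### Locally cyclic `p`-groups. -/

namespace IsLocallyCyclicPGroup

variable {p : ℕ} {G H : Type*} [Group G] [Group H]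

theorem of_mulEquiv (h : IsLocallyCyclicPGroup p G) (e : G ≃* H) :
    IsLocallyCyclicPGroup p H := by
  refine ⟨h.1.of_equiv e, fun a b => ?_⟩
  obtain ⟨c, ⟨m, hm⟩, n, hn⟩ := h.2 (e.symm a) (e.symm b)
  refine ⟨e c, ⟨m, ?_⟩, n, ?_⟩
  · simp only at hm ⊢
    rw [← map_zpow, hm, e.apply_symm_apply]
  · simp only at hn ⊢
    rw [← map_zpow, hn, e.apply_symm_apply]

/-- An element `b` of maximal order generates: a cyclic subgroup containing `b` and `g` cannot be
larger than the one generated by `b`. -/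
theorem isCyclic_of_pow_eq_one [Fact p.Prime] (h : IsLocallyCyclicPGroup p G) {n : ℕ}
    (hn : ∀ g : G, g ^ p ^ n = 1) : ∃ k ≤ n, IsCyclic G ∧ Nat.card G = p ^ k := by
  have hp : p.Prime := Fact.out
  have hE : Monoid.ExponentExists G := ⟨p ^ n, pow_pos hp.pos n, hn⟩
  have hle : ∀ g : G, orderOf g ≤ p ^ n := fun g =>
    Nat.le_of_dvd (pow_pos hp.pos n) (orderOf_dvd_of_pow_eq_one (hn g))
  obtain ⟨b, hb⟩ : ∃ b : G, ∀ g : G, orderOf g ≤ orderOf b := by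
    have hf : (Set.range (orderOf : G → ℕ)).Finite :=
      (Set.finite_Iic (p ^ n)).subset (by rintro _ ⟨g, rfl⟩; exact hle g)
    obtain ⟨_, ⟨b, rfl⟩, hb⟩ := hf.exists_maximal ⟨_, 1, rfl⟩
    exact ⟨b, fun g => not_lt.1 fun hlt => absurd (hb ⟨g, rfl⟩ hlt.le) (not_le.2 hlt)⟩
  have hgen : ∀ g : G, g ∈ Subgroup.zpowers b := by
    intro g
    obtain ⟨c, hbc, hgc⟩ := h.2 b g
    have hfc : Finite (Subgroup.zpowers c) := finite_zpowers.2 hE.isOfFinOrder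
    have : Subgroup.zpowers b = Subgroup.zpowers c :=
      Subgroup.eq_of_le_of_card_ge (Subgroup.zpowers_le.2 hbc)
        (by rw [Nat.card_zpowers, Nat.card_zpowers]; exact hb c)
    rwa [this]
  obtain ⟨k, hk, hk'⟩ := (Nat.dvd_prime_pow hp).1 (orderOf_dvd_of_pow_eq_one (hn b))
  exact ⟨k, hk, ⟨b, hgen⟩, by rw [← hk', ← orderOf_eq_card_of_forall_mem_zpowers hgen]⟩

/-- Both elements lie in one cyclic 2-group, whose only involution is `c ^ 2 ^ j`. -/
theorem eq_of_sq_eq_one (h : IsLocallyCyclicPGroup 2 G) {a b : G} (ha : a ^ 2 = 1)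
    (hb : b ^ 2 = 1) (ha' : a ≠ 1) (hb' : b ≠ 1) : a = b := by
  obtain ⟨c, hac, hbc⟩ := h.2 a b
  obtain ⟨k, hk⟩ := h.1 c
  obtain ⟨j, -, hj⟩ := (Nat.dvd_prime_pow Nat.prime_two).1 (orderOf_dvd_of_pow_eq_one hk)
  obtain _ | j := j
  · obtain rfl : c = 1 := by simpa using hj
    simp at hac
    exact absurd hac ha'
  have key : ∀ x ∈ Subgroup.zpowers c, x ^ 2 = 1 → x ≠ 1 → x = c ^ 2 ^ j := by
    rintro _ ⟨m, rfl⟩ h2 h1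
    simp only at *
    rw [← zpow_natCast, ← zpow_mul, ← orderOf_dvd_iff_zpow_eq_one, hj] at h2
    obtain ⟨t, ht⟩ := h2
    have hm : m = 2 ^ j * t := by push_cast at ht; rw [pow_succ] at ht; linarith
    rcases Int.even_or_odd' t with ⟨r, rfl | rfl⟩
    · refine absurd ?_ h1
      rw [← orderOf_dvd_iff_zpow_eq_one, hj, hm]
      exact ⟨r, by push_cast; ring⟩
    · have : m = (2 ^ j : ℕ) + (2 ^ (j + 1) : ℕ) * r := by rw [hm]; push_cast; ring
      rw [this, zpow_add, zpow_mul, zpow_natCast, zpow_natCast, ← hj, pow_orderOf_eq_one, one_zpow,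
        mul_one]
  rw [key a hac ha ha', key b hbc hb hb']

end IsLocallyCyclicPGroup

/-! ### Indecomposable abelian groups with torsion. -/

theorem isoCyclic_of_isCyclic {G : Type*} [Group G] [IsCyclic G] {n : ℕ}
    (h : Nat.card G = n) : IsoCyclic G n :=
  ⟨mulEquivOfCyclicCardEq (by rw [h, Nat.card_congr Multiplicative.toAdd, Nat.card_zmod])⟩

theorem isIndecomposable_of_isoCyclic_prime_pow {G : Type u} [Group G] {p k : ℕ} (hp : p.Prime)
    (h : IsoCyclic G (p ^ k)) : IsIndecomposable G := by
  rintro A B _ _ ⟨e⟩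
  obtain ⟨f⟩ := h
  have hc : IsCyclic (A × B) := (e.symm.trans f).isCyclic.2 inferInstance
  have hcard : Nat.card A * Nat.card B = p ^ k := by
    rw [← Nat.card_prod, Nat.card_congr (e.symm.trans f).toEquiv,
      Nat.card_congr (Multiplicative.toAdd (α := ZMod (p ^ k))), Nat.card_zmod]
  obtain ⟨i, -, hi⟩ := (Nat.dvd_prime_pow hp).1 (Dvd.intro _ hcard)
  obtain ⟨j, -, hj⟩ := (Nat.dvd_prime_pow hp).1 (Dvd.intro_left _ hcard)
  have hcop := (Group.isCyclic_prod_iff.1 hc).2.2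
  rw [hi, hj] at hcop
  have : i = 0 ∨ j = 0 := by
    by_contra! hij
    exact hp.one_lt.ne' (Nat.Coprime.eq_one_of_dvd (hcop.coprime_dvd_left (dvd_pow_self p hij.1))
      (dvd_pow_self p hij.2))
  rcases this with rfl | rfl
  · exact Or.inl (Nat.card_eq_one_iff_unique.1 (by simpa using hi)).1
  · exact Or.inr (Nat.card_eq_one_iff_unique.1 (by simpa using hj)).1

theorem eq_bot_or_eq_bot_of_isCompl {G : Type u} [CommGroup G] (hG : IsIndecomposable G)
    {H K : Subgroup G} (h : IsCompl H K) : H = ⊥ ∨ K = ⊥ := by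
  have hb : Function.Bijective (H.subtype.coprod K.subtype) := by
    constructor
    · rw [injective_iff_map_eq_one]
      rintro ⟨⟨a, ha⟩, b, hb⟩ hab
      simp only [MonoidHom.coprod_apply, Subgroup.coe_subtype] at hab
      have hbH : b ∈ H := by
        rw [eq_inv_of_mul_eq_one_right hab]; exact inv_mem ha
      have hb1 : b = 1 := Subgroup.disjoint_def.1 h.disjoint hbH hb
      subst hb1
      simp only [mul_one] at hab
      subst hab
      rfl
    · intro g
      obtain ⟨a, ha, b, hb, rfl⟩ := Subgroup.mem_sup.1
        (show g ∈ H ⊔ K by rw [h.sup_eq_top]; trivial)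
      exact ⟨(⟨a, ha⟩, ⟨b, hb⟩), rfl⟩
  rcases hG H K ⟨(MulEquiv.ofBijective _ hb).symm⟩ with h | h
  · exact Or.inl (Subgroup.eq_bot_of_subsingleton H)
  · exact Or.inr (Subgroup.eq_bot_of_subsingleton K)

/-- A cyclic subgroup generated by `y` of order `p ^ (n + 1)` such that `y ^ p ^ n` is not a
`p ^ (n + 1)`-th power has a complement. -/
theorem exists_isCompl_zpowers {G : Type*} [CommGroup G] {p n : ℕ} (hp : p.Prime) {y : G}
    (hy : y ^ p ^ (n + 1) = 1) (hn : ∀ z : G, z ^ p ^ (n + 1) ≠ y ^ p ^ n) :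
    ∃ K, IsCompl (Subgroup.zpowers y) K := by
  set N := p ^ (n + 1) with hN
  have hN0 : 0 < N := pow_pos hp.pos _
  -- Modulo `N`-th powers `y ^ p ^ n` survives, so a character of the quotient detects it. Pulled
  -- back to `G`, this character takes values killed by `N` and is faithful on the powers of `y`;
  -- its kernel is the complement.
  let P : Subgroup G := (powMonoidHom N).range
  have hxP : ((y ^ p ^ n : G) : G ⧸ P) ≠ 1 := by
    rw [ne_eq, QuotientGroup.eq_one_iff]
    rintro ⟨z, hz⟩
    exact hn z hz
  obtain ⟨c, hc⟩ := CharacterModule.exists_character_apply_ne_zero_of_ne_zero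
    (A := Additive (G ⧸ P)) (a := Additive.ofMul ((y ^ p ^ n : G) : G ⧸ P)) hxP
  let χ : Additive G →+ AddCircle (1 : ℚ) :=
    AddMonoidHom.comp c (MonoidHom.toAdditive (QuotientGroup.mk' P))
  have hχN : ∀ g, N • χ g = 0 := by
    intro g
    rw [← map_nsmul]
    have : (QuotientGroup.mk' P) ((Additive.toMul g) ^ N) = 1 :=
      (QuotientGroup.eq_one_iff _).2 ⟨_, rfl⟩
    change c (Additive.ofMul ((QuotientGroup.mk' P) ((Additive.toMul g) ^ N))) = 0
    rw [this]
    exact map_zero c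
  have hχx : p ^ n • χ (Additive.ofMul y) ≠ 0 := by
    rw [← map_nsmul]; exact hc
  have hord : addOrderOf (χ (Additive.ofMul y)) = N :=
    haveI := Fact.mk hp
    addOrderOf_eq_prime_pow hχx (hχN _)
  refine ⟨(AddMonoidHom.toMultiplicativeRight χ).ker, ?_⟩
  have hmem : ∀ g : G, g ∈ (AddMonoidHom.toMultiplicativeRight χ).ker ↔
      χ (Additive.ofMul g) = 0 := fun g => Iff.rfl
  constructor
  · rw [Subgroup.disjoint_def]
    rintro _ ⟨k, rfl⟩ hk
    simp only at hk ⊢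
    rw [hmem, ofMul_zpow, map_zsmul, ← addOrderOf_dvd_iff_zsmul_eq_zero, hord] at hk
    obtain ⟨l, rfl⟩ := hk
    rw [zpow_mul, zpow_natCast, hy, one_zpow]
  · rw [codisjoint_iff, eq_top_iff]
    rintro g -
    -- `χ g` is `m / N` and `χ y` is `l / N` with `l` prime to `N`, so `χ g` is a multiple of `χ y`.
    obtain ⟨m, -, hm⟩ := (AddCircle.nsmul_eq_zero_iff hN0).1 (hχN (Additive.ofMul g))
    obtain ⟨l, -, hlc, hl⟩ := (AddCircle.addOrderOf_eq_pos_iff hN0).1 hord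
    obtain ⟨s, hs⟩ : ∃ s : ℤ, (N : ℤ) ∣ m - s * l := by
      obtain ⟨u, v, huv⟩ := Nat.isCoprime_iff_coprime.2 hlc
      exact ⟨m * u, m * v, by linear_combination (-m : ℤ) * huv⟩
    have hgs : χ (Additive.ofMul g) = χ (Additive.ofMul (y ^ s)) := by
      obtain ⟨t, ht⟩ := hs
      rw [ofMul_zpow, map_zsmul, ← hm, ← hl, ← sub_eq_zero, ← AddCircle.coe_zsmul,
        ← AddCircle.coe_sub, AddCircle.coe_eq_zero_iff]
      refine ⟨t, ?_⟩
      have hNQ : (N : ℚ) ≠ 0 := by exact_mod_cast hN0.ne'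
      have ht' : (m : ℚ) - s * l = N * t := by exact_mod_cast ht
      simp only [zsmul_eq_mul, mul_one]
      field_simp
      linarith
    refine Subgroup.mem_sup.2 ⟨y ^ s, ⟨s, rfl⟩, (y ^ s)⁻¹ * g, ?_, by group⟩
    rw [hmem, ofMul_mul, ofMul_inv, map_add, map_neg, hgs, neg_add_cancel]

/-- A divisible subgroup of a commutative group has a complement. -/
theorem exists_isCompl_of_divisible {G : Type*} [CommGroup G] {D : Subgroup G}
    (hD : ∀ n : ℕ, n ≠ 0 → ∀ d ∈ D, ∃ e ∈ D, e ^ n = d) : ∃ K, IsCompl D K := by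
  let _ : DivisibleBy (Additive D) ℕ := divisibleByOfSMulRightSurj _ _ (by
    intro n hn d
    obtain ⟨e, he, hed⟩ := hD n hn _ (Additive.toMul d).2
    exact ⟨Additive.ofMul ⟨e, he⟩, Subtype.ext hed⟩)
  let _ : DivisibleBy (Additive D) ℤ := AddGroup.divisibleByIntOfDivisibleByNat _
  -- Injectivity of divisible groups extends the identity of `D` to a retraction of `G`, whose
  -- kernel is the complement.
  obtain ⟨f, hf⟩ := (Module.Baer.of_divisible (Additive D)).extension_property_addMonoidHom
    (MonoidHom.toAdditive D.subtype) D.subtype_injective (AddMonoidHom.id _)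
  have hf' : ∀ d : D, f (Additive.ofMul (d : G)) = Additive.ofMul d := fun d =>
    DFunLike.congr_fun hf (Additive.ofMul d)
  let φ : G →* D := MonoidHom.toAdditive.symm f
  have hφ : ∀ d : D, φ d = d := hf'
  refine ⟨φ.ker, ?_, ?_⟩
  · rw [Subgroup.disjoint_def]
    intro d hd hk
    have := hφ ⟨d, hd⟩
    rw [MonoidHom.mem_ker.1 hk] at this
    exact congrArg Subtype.val this.symm
  · rw [codisjoint_iff, eq_top_iff]
    rintro g -
    refine Subgroup.mem_sup.2 ⟨φ g, (φ g).2, (φ g : G)⁻¹ * g, ?_, by group⟩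
    rw [MonoidHom.mem_ker, map_mul, map_inv, hφ, inv_mul_cancel]


/-- If every element of order `p` is a `p ^ n`-th power for all `n`, then every element of
`p`-power order is a `p`-th power. -/
theorem exists_pow_eq_of_infinite_height {G : Type*} [CommGroup G] {p : ℕ}
    (h : ∀ x : G, x ^ p = 1 → ∀ n : ℕ, ∃ y : G, y ^ p ^ n = x) (k : ℕ) :
    ∀ g : G, g ^ p ^ k = 1 → ∃ y : G, y ^ p = g := by
  induction k with
  | zero =>
    intro g hg
    exact ⟨1, by simpa using hg.symm⟩
  | succ k ih =>
    intro g hg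
    -- Dividing `g` by `y ^ p` kills its `p ^ k`-th power, so the induction hypothesis applies to
    -- the quotient.
    obtain ⟨y, hy⟩ := h (g ^ p ^ k) (by rw [← pow_mul, ← pow_succ, hg]) (k + 1)
    obtain ⟨z, hz⟩ := ih (g * (y ^ p)⁻¹) (by
      rw [mul_pow, inv_pow, ← pow_mul, ← pow_succ', hy, mul_inv_cancel])
    exact ⟨z * y, by rw [mul_pow, hz, inv_mul_cancel_right]⟩

/-- The ascending union of the cyclic groups generated by `x 0, x 1, …`. -/
def unionZPowers {G : Type*} [Group G] (x : ℕ → G) : Subgroup G := ⨆ n, Subgroup.zpowers (x n)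

theorem mem_unionZPowers {G : Type*} [Group G] {x : ℕ → G} {p : ℕ}
    (hx : ∀ n, x (n + 1) ^ p = x n) {g : G} :
    g ∈ unionZPowers x ↔ ∃ n, g ∈ Subgroup.zpowers (x n) := by
  refine Subgroup.mem_iSup_of_directed (Monotone.directed_le (monotone_nat_of_le_succ fun n => ?_))
  rw [Subgroup.zpowers_le, ← hx n]
  exact pow_mem (Subgroup.mem_zpowers _) p

/-- Roots of order `p` come from the next stage of the tower; for a prime `r ≠ p`, the `r`-th power
map is invertible on elements of `p`-power order. -/
theorem unionZPowers_divisible {G : Type*} [CommGroup G] {x : ℕ → G} {p : ℕ} (hp : p.Prime)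
    (hx : ∀ n, x (n + 1) ^ p = x n) (h0 : x 0 ^ p = 1) (n : ℕ) (hn : n ≠ 0) :
    ∀ d ∈ unionZPowers x, ∃ e ∈ unionZPowers x, e ^ n = d := by
  have hord : ∀ k, x k ^ p ^ (k + 1) = 1 := by
    intro k
    induction k with
    | zero => simpa using h0
    | succ k ih => rw [pow_succ', pow_mul, hx, ih]
  induction n using Nat.recOnMul with
  | zero => exact absurd rfl hn
  | one => exact fun d hd => ⟨d, hd, pow_one d⟩
  | mul a b ha hb =>
    intro d hd
    obtain ⟨e, he, rfl⟩ := ha (left_ne_zero_of_mul hn) d hd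
    obtain ⟨f, hf, rfl⟩ := hb (right_ne_zero_of_mul hn) e he
    exact ⟨f, hf, by rw [mul_comm, pow_mul]⟩
  | prime r hr =>
    intro d hd
    obtain ⟨k, m, hm⟩ := (mem_unionZPowers hx).1 hd
    simp only at hm
    by_cases hrp : r = p
    · subst hrp
      exact ⟨x (k + 1) ^ m, (mem_unionZPowers hx).2 ⟨k + 1, m, rfl⟩, by
        rw [← zpow_natCast, ← zpow_mul, mul_comm, zpow_mul, zpow_natCast, hx, hm]⟩
    · have hd1 : d ^ p ^ (k + 1) = 1 := by
        rw [← hm, ← zpow_natCast, ← zpow_mul, mul_comm, zpow_mul, zpow_natCast, hord, one_zpow]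
      obtain ⟨s, hs⟩ := exists_pow_eq_self_of_coprime (x := d) (n := r)
        ((((Nat.coprime_primes hr hp).2 hrp).pow_right _).coprime_dvd_right
          (orderOf_dvd_of_pow_eq_one hd1))
      exact ⟨d ^ s, pow_mem hd s, by rw [← pow_mul, mul_comm, pow_mul, hs]⟩

/-- If all elements killed by `p` have infinite `p`-height, a tower of `p`-th roots above `x` spans
a divisible subgroup, which splits off. Otherwise an element of finite height yields a cyclic direct
factor. By indecomposability the factor is all of `G`. -/
theorem FuchsIndecomposable.IsIndecomposable.isLocallyCyclicPGroup {G : Type u} [CommGroup G]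
    (hG : IsIndecomposable G) {p : ℕ} (hp : p.Prime) {x : G} (hx : x ^ p = 1) (hx1 : x ≠ 1) :
    IsLocallyCyclicPGroup p G := by
  by_cases h : ∀ x : G, x ^ p = 1 → ∀ n : ℕ, ∃ y : G, y ^ p ^ n = x
  · choose! f hf using fun g (hg : ∃ k, g ^ p ^ k = 1) =>
      exists_pow_eq_of_infinite_height h hg.choose g hg.choose_spec
    have hord : ∀ n, (f^[n] x) ^ p ^ (n + 1) = 1 := by
      intro n
      induction n with
      | zero => simpa using hx
      | succ n ih =>
        rw [Function.iterate_succ_apply', pow_succ', pow_mul, hf _ ⟨_, ih⟩, ih]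
    have hs : ∀ n, (f^[n + 1] x) ^ p = f^[n] x := fun n => by
      rw [Function.iterate_succ_apply', hf _ ⟨_, hord n⟩]
    obtain ⟨K, hK⟩ := exists_isCompl_of_divisible (unionZPowers_divisible hp (x := (f^[·] x)) hs hx)
    have hne : unionZPowers (f^[·] x) ≠ ⊥ := by
      intro hb
      have : x ∈ unionZPowers (f^[·] x) := (mem_unionZPowers hs).2 ⟨0, Subgroup.mem_zpowers x⟩
      rw [hb] at this
      exact hx1 this
    have htop : unionZPowers (f^[·] x) = ⊤ := by
      have hK' := (eq_bot_or_eq_bot_of_isCompl hG hK).resolve_left hne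
      simpa [hK'] using hK.sup_eq_top
    have hall : ∀ g : G, ∃ n, g ∈ Subgroup.zpowers (f^[n] x) := fun g =>
      (mem_unionZPowers hs).1 (htop ▸ Subgroup.mem_top g)
    have hmono : Monotone fun n => Subgroup.zpowers (f^[n] x) :=
      monotone_nat_of_le_succ fun n => by
        rw [Subgroup.zpowers_le, ← hs n]
        exact pow_mem (Subgroup.mem_zpowers _) p
    refine ⟨fun g => ?_, fun a b => ?_⟩
    · obtain ⟨n, m, rfl⟩ := hall g
      exact ⟨n + 1, by
        simp only
        rw [← zpow_natCast, ← zpow_mul, mul_comm, zpow_mul, zpow_natCast, hord, one_zpow]⟩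
    · obtain ⟨m, hm⟩ := hall a
      obtain ⟨n, hn⟩ := hall b
      exact ⟨_, hmono (le_max_left m n) hm, hmono (le_max_right m n) hn⟩
  · push Not at h
    obtain ⟨z, hz, n, hn⟩ := h
    classical
    have hex : ∃ n, ∀ y : G, y ^ p ^ n ≠ z := ⟨n, hn⟩
    -- The least failing exponent is positive since `z` is its own first power; at the exponent `m`
    -- just below it a root `y` still exists, and `y` generates the direct factor.
    obtain ⟨m, hm⟩ : ∃ m, Nat.find hex = m + 1 := by
      refine Nat.exists_eq_succ_of_ne_zero fun h0 => ?_
      have := Nat.find_spec hex z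
      rw [h0] at this
      simp at this
    have hmin := Nat.find_min hex (m := m) (by omega)
    push Not at hmin
    obtain ⟨y, rfl⟩ := hmin
    have hspec := Nat.find_spec hex
    rw [hm] at hspec
    have hy : y ^ p ^ (m + 1) = 1 := by rw [pow_succ, pow_mul, hz]
    obtain ⟨K, hK⟩ := exists_isCompl_zpowers hp hy hspec
    have hne : Subgroup.zpowers y ≠ ⊥ := by
      rw [ne_eq, Subgroup.zpowers_eq_bot]
      rintro rfl
      exact hspec 1 (by simp)
    have htop : Subgroup.zpowers y = ⊤ := by
      have hK' := (eq_bot_or_eq_bot_of_isCompl hG hK).resolve_left hne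
      simpa [hK'] using hK.sup_eq_top
    have hall : ∀ g : G, g ∈ Subgroup.zpowers y := fun g => htop ▸ Subgroup.mem_top g
    refine ⟨fun g => ?_, fun a b => ⟨y, hall a, hall b⟩⟩
    obtain ⟨k, rfl⟩ := hall g
    exact ⟨m + 1, by
      simp only
      rw [← zpow_natCast, ← zpow_mul, mul_comm, zpow_mul, zpow_natCast, hy, one_zpow]⟩

/-! ### Powers of 2 next to powers of odd numbers. -/

section Arithmetic

/-- For odd `x` and odd `d`, if `x ^ d - 1` is up to sign a power of `2`, then it is `x - 1` up to
sign. -/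
theorem natAbs_pow_sub_one_eq {x : ℤ} (hx : Odd x) {d a : ℕ} (hd : Odd d)
    (h : (x ^ d - 1).natAbs = 2 ^ a) : (x ^ d - 1).natAbs = (x - 1).natAbs := by
  -- The cofactor of `x - 1` is a sum of `d` odd terms, hence odd; as it divides a power of 2, it is
  -- a unit.
  have hs : Odd (∑ i ∈ Finset.range d, x ^ i) := by
    have hpar : ∀ n : ℕ, Even (∑ i ∈ Finset.range n, x ^ i - n) := fun n => by
      induction n with
      | zero => simp
      | succ n ih =>
        have h1 := ih.add ((hx.pow (n := n)).sub_odd odd_one)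
        rw [Finset.sum_range_succ]
        push_cast
        rwa [add_sub_add_comm]
    simpa using (hpar d).add_odd (by exact_mod_cast hd : Odd (d : ℤ))
  have hmul := geom_sum_mul x d
  have h1 : (∑ i ∈ Finset.range d, x ^ i).natAbs = 1 := by
    have hdvd : (∑ i ∈ Finset.range d, x ^ i).natAbs ∣ 2 ^ a := by
      rw [← h, ← hmul, Int.natAbs_mul]; exact Dvd.intro _ rfl
    exact Nat.Coprime.eq_one_of_dvd
      ((Nat.coprime_two_right.2 (Int.natAbs_odd.2 hs)).pow_right a) hdvd
  rw [← hmul, Int.natAbs_mul, h1, one_mul]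

/-- The powers of an odd prime `q` of the form `2 ^ a + 1`. -/
theorem eq_one_or_of_pow_eq_two_pow_add_one {q d a : ℕ} (hq : Odd q) (hd : d ≠ 0)
    (h : q ^ d = 2 ^ a + 1) : 2 ^ a = q - 1 ∨ q = 3 ∧ a = 3 := by
  have hq0 : 1 ≤ q := hq.pos
  rcases Nat.even_or_odd' d with ⟨e, rfl | rfl⟩
  · right
    have he : e ≠ 0 := by rintro rfl; simp at hd
    -- Two powers of 2 that differ by 2 must be 4 and 2.
    have hprod : (q ^ e + 1) * (q ^ e - 1) = 2 ^ a := by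
      have := Nat.sq_sub_sq (q ^ e) 1
      rw [← this, ← pow_mul, mul_comm e 2, h]; simp
    obtain ⟨i, -, hi⟩ := (Nat.dvd_prime_pow Nat.prime_two).1 (Dvd.intro _ hprod)
    obtain ⟨j, -, hj⟩ := (Nat.dvd_prime_pow Nat.prime_two).1 (Dvd.intro_left _ hprod)
    have h1 : 1 ≤ q ^ e := Nat.one_le_pow _ _ hq0
    have hij : 2 ^ i = 2 ^ j + 2 := by omega
    have hj1 : j = 1 := by
      obtain _ | _ | j := j
      · obtain _ | _ | i := i
        · simp at hij
        · simp at hij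
        · rw [pow_succ] at hij; omega
      · rfl
      · obtain _ | _ | i := i
        · simp at hij
        · simp at hij
        · rw [pow_succ, pow_succ, pow_succ 2 (j + 1), pow_succ] at hij; omega
    subst hj1
    have hq3 : q ^ e = 3 := by omega
    have he1 : e = 1 := (Nat.Prime.eq_one_of_pow (hq3 ▸ Nat.prime_three))
    subst he1
    have : q = 3 := by simpa using hq3
    subst this
    refine ⟨rfl, ?_⟩
    have : 2 ^ a = 2 ^ 3 := by omega
    exact Nat.pow_right_injective le_rfl this
  · left
    have hodd : Odd (q : ℤ) := by exact_mod_cast hq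
    have hz : ((q : ℤ) ^ (2 * e + 1) - 1) = (2 ^ a : ℕ) := by
      have : ((q ^ (2 * e + 1) : ℕ) : ℤ) = ((2 ^ a + 1 : ℕ) : ℤ) := by rw [h]
      push_cast at this ⊢
      linarith
    have := natAbs_pow_sub_one_eq hodd ⟨e, rfl⟩ (a := a) (by rw [hz]; simp)
    rw [hz, Int.natAbs_natCast] at this
    omega

/-- The powers of `2` that exceed a power of an odd number by one. -/
theorem eq_zero_or_of_two_pow_eq_pow_add_one {p d a : ℕ} (hp : Odd p)
    (h : 2 ^ d = p ^ a + 1) : p ^ a = 1 ∨ p ^ a = p ∧ p = mersenne d := by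
  rcases Nat.even_or_odd' a with ⟨b, rfl | rfl⟩
  · left
    have hodd : Odd (p ^ b) := hp.pow
    obtain ⟨r, hr⟩ := hodd
    -- An odd square is 1 modulo 4, so `2 ^ d` is 2 modulo 4 and `d = 1`.
    have hsq : p ^ (2 * b) = 4 * (r * r + r) + 1 := by
      rw [mul_comm, pow_mul, hr]; ring
    obtain _ | _ | d := d
    · rw [hsq] at h; omega
    · omega
    · rw [hsq, pow_succ, pow_succ] at h; omega
  · right
    -- Taking `x = -p` turns `p ^ a + 1` into `x ^ a - 1` up to sign.
    have hodd : Odd (-(p : ℤ)) := by rw [odd_neg]; exact_mod_cast hp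
    have hz : ((-(p : ℤ)) ^ (2 * b + 1) - 1) = -(2 ^ d : ℕ) := by
      rw [h, Odd.neg_pow ⟨b, rfl⟩]; push_cast; ring
    have := natAbs_pow_sub_one_eq hodd ⟨b, rfl⟩ (a := d) (by rw [hz]; simp)
    rw [hz, Int.natAbs_neg, Int.natAbs_natCast] at this
    have h2 : 2 ^ d = p + 1 := by omega
    exact ⟨by omega, by rw [mersenne, h2]; rfl⟩

end Arithmetic

/-! ### Square roots of 1 and the characteristic. -/

section Units

variable {R : Type*} [CommRing R]

theorem one_add_pow_of_sq_eq_zero {y : R} (hy : y ^ 2 = 0) (n : ℕ) : (1 + y) ^ n = 1 + n * y := by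
  induction n with
  | zero => simp
  | succ n ih => rw [pow_succ, ih]; push_cast; linear_combination (n : R) * hy

theorem exists_units_of_sq_eq_zero {y : R} (hy : y ^ 2 = 0) : ∃ u : Rˣ, (u : R) = 1 + y :=
  ⟨⟨1 + y, 1 - y, by linear_combination -hy, by linear_combination -hy⟩, rfl⟩

theorem neg_one_units_ne_one (c : ℕ) [CharP R c] [Nontrivial R] (hc : c ≠ 2) : (-1 : Rˣ) ≠ 1 := by
  intro h
  have h2 : ((2 : ℕ) : R) = 0 := by
    have := congrArg Units.val h
    push_cast at this ⊢
    linear_combination -this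
  rcases (Nat.dvd_prime Nat.prime_two).1 ((CharP.cast_eq_zero_iff R c 2).1 h2) with h | h
  · exact CharP.ringChar_ne_one (R := R) (h ▸ ringChar.eq R c ▸ rfl)
  · exact hc h

theorem eq_two_of_isPGroup_units {p : ℕ} (hp : p.Prime) (h : IsPGroup p Rˣ)
    (hneg : (-1 : Rˣ) ≠ 1) : p = 2 := by
  by_contra hp2
  obtain ⟨k, hk⟩ := h (-1)
  rw [Odd.neg_one_pow (hp.odd_of_ne_two hp2).pow] at hk
  exact hneg hk

theorem eq_one_or_eq_neg_one_of_sq_eq_one (h : IsLocallyCyclicPGroup 2 Rˣ)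
    (hneg : (-1 : Rˣ) ≠ 1) {a : R} (ha : a ^ 2 = 1) : a = 1 ∨ a = -1 := by
  let u : Rˣ := ⟨a, a, by rw [← sq, ha], by rw [← sq, ha]⟩
  by_cases hu : u = 1
  · exact Or.inl (congrArg Units.val hu)
  · have : u = -1 := h.eq_of_sq_eq_one (Units.ext (by simpa [u] using ha)) (by simp) hu hneg
    exact Or.inr (by simpa [u] using congrArg Units.val this)

/-- A primitive root modulo a prime divisor of the characteristic lifts to a unit. -/
theorem exists_units_dvd_orderOf (c : ℕ) [CharP R c] (hc : c ≠ 0) {q : ℕ} (hq : q.Prime)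
    (hqc : q ∣ c) : ∃ u : Rˣ, q - 1 ∣ orderOf u := by
  have := Fact.mk hq
  have : NeZero c := ⟨hc⟩
  obtain ⟨g, hg⟩ := IsCyclic.exists_generator (α := (ZMod q)ˣ)
  obtain ⟨v, hv⟩ := ZMod.unitsMap_surjective hqc g
  have hinj : Function.Injective (Units.map (ZMod.castHom (dvd_refl c) R : ZMod c →* R)) :=
    Units.map_injective (ZMod.castHom_injective R)
  refine ⟨Units.map (ZMod.castHom (dvd_refl c) R : ZMod c →* R) v, ?_⟩
  rw [orderOf_injective _ hinj]
  have : orderOf g = q - 1 := by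
    rw [orderOf_eq_card_of_forall_mem_zpowers hg, Nat.card_eq_fintype_card, ZMod.card_units]
  rw [← this, ← hv]
  exact orderOf_map_dvd _ _

theorem char_eq_of_isLocallyCyclicPGroup (c : ℕ) [CharP R c] [Nontrivial R]
    (h : IsLocallyCyclicPGroup 2 Rˣ) (hc0 : c ≠ 0) (hc2 : c ≠ 2) :
    c = 4 ∨ ∃ q : ℕ, IsFermatPrime q ∧ (c = q ∨ c = 2 * q) := by
  have hneg := neg_one_units_ne_one (R := R) c hc2
  have hc1 : c ≠ 1 := CharP.char_ne_one R c
  -- This expresses `x ^ 2 = 1 → x = 1 ∨ x = -1` for the integer `x = n + 1` in `R`.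
  have key : ∀ n : ℕ, c ∣ (n + 1) ^ 2 - 1 → c ∣ n ∨ c ∣ n + 2 := by
    intro n hn
    have h1 : ((n : R) + 1) ^ 2 = 1 := by
      have : (((n + 1) ^ 2 - 1 : ℕ) : R) = 0 := (CharP.cast_eq_zero_iff R c _).2 hn
      rw [Nat.cast_sub (Nat.one_le_pow _ _ n.succ_pos)] at this
      push_cast at this
      linear_combination this
    rcases eq_one_or_eq_neg_one_of_sq_eq_one h hneg h1 with h2 | h2
    · exact Or.inl ((CharP.cast_eq_zero_iff R c _).1 (by linear_combination h2))
    · exact Or.inr ((CharP.cast_eq_zero_iff R c _).1 (by push_cast; linear_combination h2))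
  by_cases hodd : ∃ p, p.Prime ∧ p ≠ 2 ∧ p ∣ c
  · right
    obtain ⟨p, hp, hp2, m, rfl⟩ := hodd
    have hm0 : m ≠ 0 := right_ne_zero_of_mul hc0
    -- If `p ∣ m`, then `m` squares to zero in `R` and `1 + m` is a unit of order dividing the odd
    -- prime `p` in a 2-group, which forces `m = 0` in `R`.
    have hpm : ¬ p ∣ m := by
      rintro hpm
      have hsq : (m : R) ^ 2 = 0 := by
        rw [← Nat.cast_pow, CharP.cast_eq_zero_iff R (p * m), sq]
        exact Nat.mul_dvd_mul_right hpm m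
      obtain ⟨u, hu⟩ := exists_units_of_sq_eq_zero hsq
      have hup : u ^ p = 1 := by
        ext
        rw [Units.val_pow_eq_pow_val, hu, one_add_pow_of_sq_eq_zero hsq, ← Nat.cast_mul,
          CharP.cast_eq_zero R (p * m), add_zero, Units.val_one]
      obtain ⟨k, hk⟩ := h.1 u
      have hu1 : u = 1 := by
        have := Nat.dvd_gcd (orderOf_dvd_of_pow_eq_one hup) (orderOf_dvd_of_pow_eq_one hk)
        rw [Nat.Coprime.gcd_eq_one (((Nat.coprime_primes hp Nat.prime_two).2 hp2).pow_right k)]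
          at this
        exact orderOf_eq_one_iff.1 (Nat.dvd_one.1 this)
      have hm : (m : R) = 0 := by
        rw [hu1, Units.val_one] at hu
        linear_combination -hu
      have := Nat.le_of_dvd (Nat.pos_of_ne_zero hm0) ((CharP.cast_eq_zero_iff R (p * m) m).1 hm)
      nlinarith [hp.two_le, Nat.pos_of_ne_zero hm0]
    have hcop : p.Coprime m := (Nat.Prime.coprime_iff_not_dvd hp).2 hpm
    have hm2 : m ≤ 2 := by
      by_contra! hm2
      -- By the Chinese remainder theorem `n + 1` is 1 modulo `p` and -1 modulo `m`: a square root
      -- of 1 other than `±1` when `m > 2`.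
      obtain ⟨n, hn1, hn2⟩ := Nat.chineseRemainder hcop 0 (m - 2)
      have hpn : p ∣ n := (Nat.modEq_zero_iff_dvd).1 hn1
      have hmn : m ∣ n + 2 := by
        have := hn2.add_right 2
        rw [Nat.sub_add_cancel (by omega)] at this
        exact (Nat.modEq_zero_iff_dvd).1 (this.trans (by simp [Nat.ModEq]))
      have hfac : (n + 1) ^ 2 - 1 = n * (n + 2) := by
        have : (n + 1) ^ 2 = n * (n + 2) + 1 := by ring
        omega
      rcases key n (hfac ▸ mul_dvd_mul hpn hmn) with h1 | h1
      · have := (Nat.dvd_add_right ((Dvd.intro_left _ rfl).trans h1)).1 hmn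
        exact absurd (Nat.le_of_dvd two_pos this) (by omega)
      · have := (Nat.dvd_add_right hpn).1 ((Dvd.intro _ rfl).trans h1)
        exact hp2 ((Nat.prime_dvd_prime_iff_eq hp Nat.prime_two).1 this)
    have hF : IsFermatPrime p := by
      refine ⟨hp, ?_⟩
      obtain ⟨u, hu⟩ := exists_units_dvd_orderOf (R := R) (p * m) hc0 hp (Dvd.intro _ rfl)
      obtain ⟨k, hk⟩ := h.1 u
      obtain ⟨j, -, hj⟩ := (Nat.dvd_prime_pow Nat.prime_two).1
        (hu.trans (orderOf_dvd_of_pow_eq_one hk))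
      have hpj : p = 2 ^ j + 1 := by have := hp.two_le; omega
      have hj0 : j ≠ 0 := by rintro rfl; exact hp2 (by simpa using hpj)
      obtain ⟨i, rfl⟩ := Nat.pow_of_pow_add_prime one_lt_two hj0 (hpj ▸ hp)
      exact ⟨i, hpj⟩
    refine ⟨p, hF, ?_⟩
    interval_cases m <;> simp_all [mul_comm]
  · left
    push Not at hodd
    obtain ⟨k, hk⟩ : ∃ k, c = 2 ^ k :=
      ⟨_, Nat.eq_prime_pow_of_unique_prime_dvd hc0 fun {p} hp hpc => by
        by_contra h2; exact hodd p hp h2 hpc⟩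
    subst hk
    obtain _ | _ | _ | k := k
    · simp at hc1
    · simp at hc2
    · rfl
    · exfalso
      have hpos : 0 < 2 ^ k := by positivity
      -- Modulo a power of 2 that is at least 8, half the modulus plus one is a further square root
      -- of 1.
      have hdvd : 2 ^ (k + 1 + 1 + 1) ∣ (2 ^ (k + 2) + 1) ^ 2 - 1 := by
        refine ⟨2 ^ (k + 1) + 1, ?_⟩
        have : (2 ^ (k + 2) + 1) ^ 2 = 2 ^ (k + 1 + 1 + 1) * (2 ^ (k + 1) + 1) + 1 := by ring
        omega
      have e1 : 2 ^ (k + 1 + 1 + 1) = 8 * 2 ^ k := by ring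
      have e2 : 2 ^ (k + 2) = 4 * 2 ^ k := by ring
      rcases key _ hdvd with h1 | h1
      · have := Nat.le_of_dvd (by positivity) h1
        omega
      · rw [e1, e2] at h1
        have := Nat.le_of_dvd (by positivity) h1
        have hk0 : k = 0 := by
          by_contra hk0
          have : 2 ≤ 2 ^ k := Nat.le_self_pow hk0 2
          omega
        subst hk0
        norm_num at h1

end Units

/-! ### Bounds for the exponent of the unit group. -/

section Exponent

variable {R : Type*} [CommRing R]

/-- In characteristic zero there is no unit `z` with `z ^ 4 = -1` if the unit group is a `2`-group:
otherwise `1 + z + z⁻¹ = 1 + √2` would be a unit of infinite order. -/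
theorem units_pow_four_ne_neg_one [CharZero R] (h : IsPGroup 2 Rˣ) (z : Rˣ) : z ^ 4 ≠ -1 := by
  intro hz
  have hz' : (z : R) ^ 4 = -1 := by simpa using congrArg Units.val hz
  obtain ⟨s, hs⟩ : ∃ s : R, s ^ 2 = 2 := by
    -- As `z ^ 4 = -1`, this is `z + z⁻¹`.
    refine ⟨z - z ^ 3, ?_⟩
    linear_combination ((z : R) ^ 2 - 2) * hz'
  let u : Rˣ := ⟨1 + s, s - 1, by linear_combination hs, by linear_combination hs⟩
  have key : ∀ n : ℕ, ∃ a b : ℕ, 0 < a ∧ 0 < b ∧ (1 + s) ^ (n + 1) = a + b * s := by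
    intro n
    induction n with
    | zero => exact ⟨1, 1, one_pos, one_pos, by simp⟩
    | succ n ih =>
      obtain ⟨a, b, ha, hb, hab⟩ := ih
      exact ⟨a + 2 * b, a + b, by omega, by omega, by
        rw [pow_succ, hab]; push_cast; linear_combination (b : R) * hs⟩
  obtain ⟨k, hk⟩ := h u
  obtain ⟨n, hn⟩ := Nat.exists_eq_succ_of_ne_zero (show 2 ^ k ≠ 0 by positivity)
  obtain ⟨a, b, ha, hb, hab⟩ := key n
  rw [← Nat.succ_eq_add_one, ← hn] at hab
  have hu : (1 + s) ^ 2 ^ k = 1 := by simpa [u] using congrArg Units.val hk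
  -- A power of `1 + s` equal to 1 gives `b * s = 1 - a` with `b > 0`; squaring contradicts the
  -- irrationality of `√2`.
  have hsq : ((2 * b ^ 2 : ℕ) : R) = (((a - 1) ^ 2 : ℕ) : R) := by
    obtain ⟨a, rfl⟩ := Nat.exists_eq_succ_of_ne_zero ha.ne'
    rw [hu] at hab
    push_cast at hab ⊢
    have : (b : R) * s = -a := by linear_combination -hab
    linear_combination (-(b : R) ^ 2) * hs + (b * s - a) * this
  have hsq' : 2 * b ^ 2 = (a - 1) ^ 2 := Nat.cast_injective hsq
  obtain ⟨t, ht⟩ := (Nat.pow_dvd_pow_iff two_ne_zero).1 (Dvd.intro_left _ hsq')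
  rw [ht, mul_pow, mul_comm] at hsq'
  have := Nat.eq_of_mul_eq_mul_left (by positivity) hsq'
  have : t < 2 := by nlinarith
  interval_cases t <;> omega

/-- If `u ^ 8 = 1` but `u ^ 4 ≠ 1`, then `u ^ 4` is the unique involution `-1`; induction on the
order reduces to this case. -/
theorem units_pow_four_eq_one_of_ne_neg_one (h : IsLocallyCyclicPGroup 2 Rˣ)
    (hneg : (-1 : Rˣ) ≠ 1) (h4 : ∀ z : Rˣ, z ^ 4 ≠ -1) (u : Rˣ) : u ^ 4 = 1 := by
  obtain ⟨k, hk⟩ := h.1 u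
  induction k generalizing u with
  | zero => rw [pow_zero, pow_one] at hk; rw [hk, one_pow]
  | succ k ih =>
    have h8 : (u ^ 2) ^ 4 = 1 := ih _ (by rw [← pow_mul, ← pow_succ', hk])
    by_contra hu
    exact h4 u (h.eq_of_sq_eq_one (by rw [← h8]; group) (by simp) hu hneg)

theorem units_pow_four_eq_one_of_charZero [CharZero R] (h : IsLocallyCyclicPGroup 2 Rˣ)
    (u : Rˣ) : u ^ 4 = 1 :=
  units_pow_four_eq_one_of_ne_neg_one h (neg_one_units_ne_one 0 (by simp))
    (units_pow_four_ne_neg_one h.1) u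

theorem units_pow_four_eq_one_of_char_four [CharP R 4] [Nontrivial R]
    (h : IsLocallyCyclicPGroup 2 Rˣ) (u : Rˣ) : u ^ 4 = 1 := by
  have hneg := neg_one_units_ne_one (R := R) 4 (by simp)
  refine units_pow_four_eq_one_of_ne_neg_one h hneg (fun z hz => ?_) u
  have h4 : (4 : R) = 0 := by exact_mod_cast CharP.cast_eq_zero R 4
  have h2 : (2 : R) ≠ 0 := by
    intro h2
    have := (CharP.cast_eq_zero_iff R 4 2).1 (by exact_mod_cast h2)
    omega
  have hz' : (z : R) ^ 4 = -1 := by simpa using congrArg Units.val hz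
  -- Since `4 = 0`, the element `1 + 2 * z` squares to 1; it is not 1, because `z` is a unit and `2
  -- ≠ 0`.
  have h2z : 2 * (z : R) = 2 := by
    rcases eq_one_or_eq_neg_one_of_sq_eq_one h hneg (a := 1 + 2 * (z : R))
      (by linear_combination ((z : R) + z ^ 2) * h4) with h1 | h1
    · exact absurd ((Units.mul_left_eq_zero z).1 (by linear_combination h1)) h2
    · linear_combination h1 - h4
  obtain ⟨x, hx⟩ : ∃ x : R, x = z - 1 := ⟨_, rfl⟩
  have h2x : 2 * x = 0 := by rw [hx]; linear_combination h2z
  have hzx : (z : R) = 1 + x := by rw [hx]; ring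
  have hx4 : x ^ 4 = 2 := by
    rw [hzx] at hz'
    linear_combination hz' - (2 + 3 * x + 2 * x ^ 2) * h2x - h4
  -- From `x ^ 4 = 2` and `2 * x = 0` one gets `x ^ 6 = 0`, so `1 + x ^ 3` squares to 1. Either
  -- value of `x ^ 3`, multiplied by `x`, gives `x ^ 4 = 0`.
  rcases eq_one_or_eq_neg_one_of_sq_eq_one h hneg (a := 1 + x ^ 3)
    (by linear_combination (x ^ 2) * hx4 + (x ^ 2 + x) * h2x) with h1 | h1
  · exact h2 (by linear_combination x * h1 - hx4)
  · exact h2 (by linear_combination x * h1 - hx4 - h2x)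

theorem units_pow_four_eq_one_of_char_two [CharP R 2]
    (h : IsLocallyCyclicPGroup 2 Rˣ) (u : Rˣ) : u ^ 4 = 1 := by
  have h2 : (2 : R) = 0 := by exact_mod_cast CharP.cast_eq_zero R 2
  obtain ⟨k, hk⟩ := h.1 u
  induction k generalizing u with
  | zero => rw [pow_zero, pow_one] at hk; rw [hk, one_pow]
  | succ k ih =>
    have h8 : (u ^ 2) ^ 4 = 1 := ih _ (by rw [← pow_mul, ← pow_succ', hk])
    by_contra hu
    have hu8 : (u : R) ^ 8 = 1 := by
      rw [← pow_mul] at h8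
      simpa using congrArg Units.val h8
    obtain ⟨x, hx⟩ : ∃ x : R, x = u - 1 := ⟨_, rfl⟩
    have hux : (u : R) = 1 + x := by rw [hx]; ring
    have hu4 : (u : R) ^ 4 = 1 + x ^ 4 := by
      rw [hux]; linear_combination (2 * x + 3 * x ^ 2 + 2 * x ^ 3) * h2
    have hx8 : x ^ 8 = 0 := by
      have : (u : R) ^ 8 = 1 + x ^ 8 := by
        rw [show (u : R) ^ 8 = (u ^ 4) ^ 2 by ring, hu4]; linear_combination x ^ 4 * h2
      linear_combination hu8 - this
    -- For `y` square-zero, `1 + y` squares to 1, and `u ^ 4 = 1 + x ^ 4` is the only involution.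
    -- Applied to `x ^ 5` and then to `x ^ 3`, this forces `x ^ 4 = 0`.
    have key : ∀ y : R, y ^ 2 = 0 → y = 0 ∨ y = x ^ 4 := by
      intro y hy
      obtain ⟨v, hv⟩ := exists_units_of_sq_eq_zero hy
      by_cases hv1 : v = 1
      · left
        rw [hv1, Units.val_one] at hv
        linear_combination -hv
      · right
        have hvu : v = u ^ 4 := by
          refine h.eq_of_sq_eq_one ?_ (by rw [← h8]; group) hv1 hu
          ext
          rw [Units.val_pow_eq_pow_val, hv, Units.val_one]
          linear_combination hy + y * h2
        have := congrArg Units.val hvu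
        rw [hv, Units.val_pow_eq_pow_val, hu4] at this
        exact add_left_cancel this
    have hx4 : x ^ 4 ≠ 0 := fun h0 => hu (by ext; simp [hu4, h0])
    have hx5 : x ^ 5 = 0 :=
      (key (x ^ 5) (by linear_combination x ^ 2 * hx8)).resolve_right fun h5 =>
        hx4 (by linear_combination (-1 - x - x ^ 2 - x ^ 3) * h5 + hx8)
    rcases key (x ^ 3) (by linear_combination x * hx5) with h3 | h3
    · exact hx4 (by linear_combination x * h3)
    · exact hx4 (by linear_combination x * h3 + hx5)

/-- For `y ^ 2 = 0` the order of `1 + y` is a power of 2 dividing `c`, hence at most 2. The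
alternative `1 + y = -1` would give `4 = y ^ 2 = 0`, which the assumptions on `c` rule out. -/
theorem isReduced_of_isLocallyCyclicPGroup (c : ℕ) [CharP R c] [Nontrivial R] (hc2 : c ≠ 2)
    (hc4 : ¬ 4 ∣ c) (h : IsLocallyCyclicPGroup 2 Rˣ) : IsReduced R := by
  have hneg := neg_one_units_ne_one (R := R) c hc2
  rw [isReduced_iff_pow_one_lt 2 one_lt_two]
  intro y hy
  obtain ⟨u, hu⟩ := exists_units_of_sq_eq_zero hy
  obtain ⟨k, hk⟩ := h.1 u
  have huc : u ^ c = 1 := by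
    ext
    rw [Units.val_pow_eq_pow_val, hu, one_add_pow_of_sq_eq_zero hy, CharP.cast_eq_zero]
    simp
  have hu2 : u ^ 2 = 1 := by
    obtain ⟨i, -, hi⟩ := (Nat.dvd_prime_pow Nat.prime_two).1 (orderOf_dvd_of_pow_eq_one hk)
    rw [← orderOf_dvd_iff_pow_eq_one, hi]
    have hic : 2 ^ i ∣ c := hi ▸ orderOf_dvd_of_pow_eq_one huc
    refine pow_dvd_pow 2 (n := 1) (not_lt.1 fun h2 => hc4 ?_)
    exact (pow_dvd_pow 2 (show 2 ≤ i from h2)).trans hic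
  rcases eq_one_or_eq_neg_one_of_sq_eq_one h hneg (a := 1 + y)
    (by simpa [hu] using congrArg Units.val hu2) with h1 | h1
  · linear_combination h1
  · have h4 : ((4 : ℕ) : R) = 0 := by push_cast; linear_combination hy - (y - 2) * h1
    have hc := (CharP.cast_eq_zero_iff R c 4).1 h4
    have := CharP.char_ne_one R c
    have hle := Nat.le_of_dvd (by norm_num) hc
    interval_cases c <;> simp_all

theorem isReduced_of_isPGroup_of_char_two [CharP R 2] {p : ℕ} (hp : p.Prime) (hp2 : p ≠ 2)
    (h : IsPGroup p Rˣ) : IsReduced R := by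
  rw [isReduced_iff_pow_one_lt 2 one_lt_two]
  intro y hy
  obtain ⟨u, hu⟩ := exists_units_of_sq_eq_zero hy
  obtain ⟨k, hk⟩ := h u
  have hu2 : u ^ 2 = 1 := by
    ext
    rw [Units.val_pow_eq_pow_val, hu, one_add_pow_of_sq_eq_zero hy, CharP.cast_eq_zero]
    simp
  have hu1 : u = 1 := by
    have := Nat.dvd_gcd (orderOf_dvd_of_pow_eq_one hu2) (orderOf_dvd_of_pow_eq_one hk)
    rw [Nat.Coprime.gcd_eq_one (((Nat.coprime_primes Nat.prime_two hp).2 hp2.symm).pow_right k)]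
      at this
    exact orderOf_eq_one_iff.1 (Nat.dvd_one.1 this)
  rw [hu1, Units.val_one] at hu
  linear_combination -hu

/-- The residue fields of a finite reduced ring inherit the property that the unit group is
a `p`-group. -/
theorem isPGroup_units_quotient {S : Type*} [CommRing S] [IsArtinianRing S] [IsReduced S] {p : ℕ}
    (h : IsPGroup p Sˣ) (m : MaximalSpectrum S) : IsPGroup p (S ⧸ m.asIdeal)ˣ := by
  classical
  intro w
  let e := IsArtinianRing.equivPi S
  let W : (∀ I : MaximalSpectrum S, S ⧸ I.asIdeal)ˣ := MulEquiv.piUnits.symm (Pi.mulSingle m w)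
  obtain ⟨k, hk⟩ := h (Units.mapEquiv e.symm.toMulEquiv W)
  refine ⟨k, ?_⟩
  rw [← map_pow, EmbeddingLike.map_eq_one_iff] at hk
  have := congrFun (congrArg MulEquiv.piUnits hk) m
  simpa [W] using this

/-- The unit `u` generates a finite reduced subring, a product of finite fields. Their unit groups
are `p`-groups, so each field has `r ^ d = p ^ a + 1` elements with `r ∣ c`; the hypothesis `hn`
makes `n` a multiple of every such `p ^ a`. -/
theorem units_pow_eq_one_of_isReduced (c : ℕ) [CharP R c] (hc : c ≠ 0) [IsReduced R] {p n : ℕ}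
    (hp : p.Prime) (h : IsPGroup p Rˣ)
    (hn : ∀ r d a : ℕ, r.Prime → r ∣ c → d ≠ 0 → r ^ d = p ^ a + 1 → p ^ a ∣ n) (u : Rˣ) :
    u ^ n = 1 := by
  have := Fact.mk hp
  have : NeZero c := ⟨hc⟩
  obtain ⟨k, hk⟩ := h u
  have huk : (u : R) ^ p ^ k = 1 := by simpa using congrArg Units.val hk
  let _ : Algebra (ZMod c) R := ZMod.algebra R c
  let S := Algebra.adjoin (ZMod c) {(u : R)}
  have hint : IsIntegral (ZMod c) (u : R) :=
    IsIntegral.of_pow (pow_pos hp.pos k) (huk ▸ isIntegral_one)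
  have hfin : Module.Finite (ZMod c) S := Algebra.finite_adjoin_simple_of_isIntegral hint
  have : Finite S := Module.finite_of_finite (ZMod c)
  have : IsReduced S := isReduced_of_injective S.val Subtype.val_injective
  have hS : IsPGroup p Sˣ :=
    h.of_injective (Units.map (S.val : S →* R)) (Units.map_injective Subtype.val_injective)
  let z : S := ⟨u, Algebra.self_mem_adjoin_singleton _ _⟩
  have hz : z ^ p ^ k = 1 := Subtype.ext huk
  suffices z ^ n = 1 by
    ext
    simpa [z] using congrArg Subtype.val this
  apply (IsArtinianRing.equivPi S).injective
  funext m
  rw [map_pow, map_one, Pi.pow_apply, Pi.one_apply, IsArtinianRing.equivPi_apply]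
  let _ : Field (S ⧸ m.asIdeal) := Ideal.Quotient.field _
  have : Finite (S ⧸ m.asIdeal) := Finite.of_surjective _ Ideal.Quotient.mk_surjective
  let _ : Fintype (S ⧸ m.asIdeal) := Fintype.ofFinite _
  obtain ⟨r, hr⟩ := CharP.exists (S ⧸ m.asIdeal)
  obtain ⟨d, hrp, hcard⟩ := FiniteField.card (S ⧸ m.asIdeal) r
  have hrc : r ∣ c := by
    rw [← CharP.cast_eq_zero_iff (S ⧸ m.asIdeal) r]
    have : ((c : ℕ) : S) = 0 := Subtype.ext (by simp)
    simpa using congrArg (Ideal.Quotient.mk m.asIdeal) this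
  obtain ⟨a, ha⟩ := IsPGroup.iff_card.1 (isPGroup_units_quotient hS m)
  have hcard' : r ^ (d : ℕ) = p ^ a + 1 := by
    rw [← hcard, ← ha, ← Nat.card_eq_fintype_card, Nat.card_eq_card_units_add_one]
  obtain ⟨b, hb⟩ := hn r d a hrp hrc d.ne_zero hcard'
  have hzk : (Ideal.Quotient.mk m.asIdeal z) ^ p ^ k = 1 := by rw [← map_pow, hz, map_one]
  have hz0 : Ideal.Quotient.mk m.asIdeal z ≠ 0 := by
    intro h0
    rw [h0, zero_pow (pow_pos hp.pos k).ne'] at hzk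
    exact zero_ne_one hzk
  have := pow_card_eq_one' (x := Units.mk0 _ hz0)
  rw [ha] at this
  have h1 : (Ideal.Quotient.mk m.asIdeal z) ^ p ^ a = 1 := by simpa using congrArg Units.val this
  change (Ideal.Quotient.mk m.asIdeal z) ^ n = 1
  rw [hb, pow_mul, h1, one_pow]

end Exponent

/-! ### The classification for commutative rings. -/

section Classification

theorem FuchsIndecomposable.IsFermatPrime.exists_eq {q : ℕ} (hq : IsFermatPrime q) :
    ∃ j : ℕ, j ≠ 0 ∧ q = 2 ^ j + 1 := by
  obtain ⟨-, m, rfl⟩ := hq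
  exact ⟨2 ^ m, by positivity, rfl⟩

theorem FuchsIndecomposable.IsFermatPrime.odd {q : ℕ} (hq : IsFermatPrime q) : Odd q := by
  obtain ⟨j, hj, rfl⟩ := hq.exists_eq
  exact (even_two.pow_of_ne_zero hj).add_one

theorem FuchsIndecomposable.IsoCyclic.of_mulEquiv {G H : Type*} [Group G] [Group H] {n : ℕ}
    (h : IsoCyclic G n) (e : G ≃* H) : IsoCyclic H n :=
  h.map e.symm.trans

/-- The cyclic groups that the classification allows in characteristic `c`. -/
def IsListedCyclic (c : ℕ) (G : Type*) [Group G] : Prop :=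
  ((c = 0 ∨ c = 4) ∧ (IsoCyclic G 2 ∨ IsoCyclic G 4)) ∨
  (c = 2 ∧ (IsoCyclic G 2 ∨ IsoCyclic G 4 ∨ ∃ p, IsMersennePrime p ∧ IsoCyclic G p)) ∨
  ∃ q, IsFermatPrime q ∧ (c = q ∨ c = 2 * q) ∧
    ((q = 3 ∧ (IsoCyclic G 2 ∨ IsoCyclic G 8)) ∨ (3 < q ∧ IsoCyclic G (q - 1)))

theorem isoCyclic_two_or_four {G : Type*} [Group G] [Nontrivial G]
    (h : IsLocallyCyclicPGroup 2 G) (h4 : ∀ g : G, g ^ 4 = 1) : IsoCyclic G 2 ∨ IsoCyclic G 4 := by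
  obtain ⟨k, hk, hc, hcard⟩ := h.isCyclic_of_pow_eq_one (n := 2) h4
  have hk0 : k ≠ 0 := by
    rintro rfl
    have := (Nat.card_eq_one_iff_unique.1 (by simpa using hcard)).1
    exact not_subsingleton G this
  obtain rfl | rfl : k = 1 ∨ k = 2 := by omega
  · exact Or.inl (isoCyclic_of_isCyclic (by simpa using hcard))
  · exact Or.inr (isoCyclic_of_isCyclic (by simpa using hcard))

variable {R : Type*} [CommRing R] [Nontrivial R]

theorem units_pow_eq_one_of_fermat (c : ℕ) [CharP R c] {q n : ℕ} (hq : IsFermatPrime q)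
    (hc : c = q ∨ c = 2 * q) (h : IsLocallyCyclicPGroup 2 Rˣ) (hn : q - 1 ∣ n)
    (hn3 : q = 3 → 8 ∣ n) (u : Rˣ) : u ^ n = 1 := by
  have hodd := hq.odd
  have hq2 := hq.1.two_le
  have := isReduced_of_isLocallyCyclicPGroup (R := R) c (by
    rintro rfl; obtain ⟨t, rfl⟩ := hodd; omega)
    (by obtain ⟨t, rfl⟩ := hodd; omega) h
  refine units_pow_eq_one_of_isReduced c (by omega) Nat.prime_two h.1 (fun r d a hr hrc hd hra => ?_) u
  have hr' : r = 2 ∨ r = q := by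
    rcases hc with rfl | rfl
    · exact Or.inr ((Nat.prime_dvd_prime_iff_eq hr hq.1).1 hrc)
    · exact (hr.dvd_mul.1 hrc).imp (Nat.prime_dvd_prime_iff_eq hr Nat.prime_two).1
        (Nat.prime_dvd_prime_iff_eq hr hq.1).1
  rcases hr' with rfl | rfl
  · obtain _ | a := a
    · simp
    · exfalso
      obtain ⟨d, rfl⟩ := Nat.exists_eq_succ_of_ne_zero hd
      rw [pow_succ, pow_succ] at hra
      omega
  · rcases eq_one_or_of_pow_eq_two_pow_add_one hodd hd hra with h1 | ⟨h1, rfl⟩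
    · rwa [h1]
    · exact hn3 h1

theorem isoCyclic_units_of_fermat (c : ℕ) [CharP R c] {q : ℕ} (hq : IsFermatPrime q) (hq3 : 3 < q)
    (hc : c = q ∨ c = 2 * q) (h : IsLocallyCyclicPGroup 2 Rˣ) : IsoCyclic Rˣ (q - 1) := by
  obtain ⟨j, -, hj⟩ := hq.exists_eq
  have hj' : q - 1 = 2 ^ j := by omega
  obtain ⟨k, -, hcyc, hcard⟩ := h.isCyclic_of_pow_eq_one (n := j) (fun u => by
    rw [← hj']
    exact units_pow_eq_one_of_fermat c hq hc h dvd_rfl (fun h => absurd h hq3.ne') u)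
  obtain ⟨v, hv⟩ := IsCyclic.exists_generator (α := Rˣ)
  -- The lifted primitive root shows that the bound `q - 1` is attained.
  obtain ⟨u, hu⟩ := exists_units_dvd_orderOf (R := R) c (by have := hq.1.pos; omega) hq.1
    (by rcases hc with rfl | rfl <;> simp)
  refine isoCyclic_of_isCyclic (Nat.dvd_antisymm ?_ (hu.trans (orderOf_dvd_natCard u)))
  rw [← orderOf_eq_card_of_forall_mem_zpowers hv]
  exact orderOf_dvd_of_pow_eq_one
    (units_pow_eq_one_of_fermat c hq hc h dvd_rfl (fun h => absurd h hq3.ne') v)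

theorem isoCyclic_units_of_char_three_or_six (c : ℕ) [CharP R c] (hc : c = 3 ∨ c = 6)
    (h : IsLocallyCyclicPGroup 2 Rˣ) : IsoCyclic Rˣ 2 ∨ IsoCyclic Rˣ 8 := by
  have hneg := neg_one_units_ne_one (R := R) c (by omega)
  have hF : IsFermatPrime 3 := ⟨Nat.prime_three, 0, rfl⟩
  obtain ⟨k, hk, hcyc, hcard⟩ := h.isCyclic_of_pow_eq_one (n := 3)
    (units_pow_eq_one_of_fermat c hF hc h (by norm_num) (by norm_num))
  have h6 : (6 : R) = 0 := by
    have : ((6 : ℕ) : R) = 0 := (CharP.cast_eq_zero_iff R c 6).2 (by rcases hc with rfl | rfl <;> norm_num)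
    exact_mod_cast this
  interval_cases k
  · have := (Nat.card_eq_one_iff_unique.1 (by simpa using hcard)).1
    exact absurd (Subsingleton.elim _ _) hneg
  · exact Or.inl (isoCyclic_of_isCyclic (by simpa using hcard))
  · exfalso
    obtain ⟨z, hz⟩ := IsCyclic.exists_generator (α := Rˣ)
    have hord : orderOf z = 4 := by rw [orderOf_eq_card_of_forall_mem_zpowers hz, hcard]; norm_num
    have hall : ∀ u : Rˣ, u ^ 4 = 1 := fun u => by
      have := pow_card_eq_one' (x := u); rwa [hcard] at this
    have hz2 : z ^ 2 = -1 := by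
      refine h.eq_of_sq_eq_one (by rw [← pow_mul]; exact hall z) (by simp) (fun h2 => ?_) hneg
      have := orderOf_dvd_of_pow_eq_one h2
      rw [hord] at this
      omega
    have hz2' : (z : R) ^ 2 = -1 := by simpa using congrArg Units.val hz2
    -- This element is `1 + z` modulo 3, of order 8 as in the field with nine elements, and 1 modulo
    -- 2. One formula thus serves both characteristics; its fourth power is `-1`, against exponent
    -- 4.
    have h2 : (4 * (1 + z) + 3 : R) ^ 2 = 2 * z + 3 := by
      linear_combination 16 * hz2' + (9 * (z : R) + 5) * h6
    have h4 : (4 * (1 + z) + 3 : R) ^ 4 = -1 := by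
      rw [show (4 * (1 + z) + 3 : R) ^ 4 = ((4 * (1 + z) + 3) ^ 2) ^ 2 by ring, h2]
      linear_combination 4 * hz2' + (2 * (z : R) + 1) * h6
    let v : Rˣ := ⟨4 * (1 + z) + 3, -(4 * (1 + z) + 3) ^ 3, by linear_combination -h4,
      by linear_combination -h4⟩
    refine hneg (Eq.trans ?_ (hall v))
    ext
    simp [v, h4]
  · exact Or.inr (isoCyclic_of_isCyclic (by simpa using hcard))

theorem isListedCyclic_units (c : ℕ) [CharP R c] {p : ℕ} (hp : p.Prime)
    (h : IsLocallyCyclicPGroup p Rˣ) [Nontrivial Rˣ] : IsListedCyclic c Rˣ := by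
  by_cases hc2 : c = 2
  · subst hc2
    refine Or.inr (Or.inl ⟨rfl, ?_⟩)
    by_cases hp2 : p = 2
    · subst hp2
      rcases isoCyclic_two_or_four h (units_pow_four_eq_one_of_char_two h) with h | h
      · exact Or.inl h
      · exact Or.inr (Or.inl h)
    · refine Or.inr (Or.inr ⟨p, ?_⟩)
      have := Fact.mk hp
      have hodd := hp.odd_of_ne_two hp2
      have := isReduced_of_isPGroup_of_char_two (R := R) hp hp2 h.1
      have hpow : ∀ u : Rˣ, u ^ p = 1 :=
        units_pow_eq_one_of_isReduced 2 two_ne_zero hp h.1 fun r d a hr hr2 _ hra => by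
          rw [(Nat.prime_dvd_prime_iff_eq hr Nat.prime_two).1 hr2] at hra
          rcases eq_zero_or_of_two_pow_eq_pow_add_one hodd hra with h | h
          · rw [h]; exact one_dvd p
          · rw [h.1]
      refine ⟨⟨hp, ?_⟩, ?_⟩
      -- If `p` is not a Mersenne prime, only residue fields with two elements remain, so every unit
      -- is trivial.
      · by_contra hm
        obtain ⟨u, hu⟩ := exists_ne (1 : Rˣ)
        refine hu ?_
        rw [← pow_one u]
        refine units_pow_eq_one_of_isReduced 2 two_ne_zero hp h.1 (fun r d a hr hr2 _ hra => ?_) u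
        rw [(Nat.prime_dvd_prime_iff_eq hr Nat.prime_two).1 hr2] at hra
        rcases eq_zero_or_of_two_pow_eq_pow_add_one hodd hra with h | h
        · rw [h]
        · exact absurd ⟨d, h.2⟩ hm
      · obtain ⟨k, hk, hcyc, hcard⟩ := h.isCyclic_of_pow_eq_one (n := 1) (by simpa using hpow)
        obtain rfl | rfl : k = 0 ∨ k = 1 := by omega
        · have := (Nat.card_eq_one_iff_unique.1 (by simpa using hcard)).1
          exact absurd this (not_subsingleton Rˣ)
        · exact isoCyclic_of_isCyclic (by simpa using hcard)
  · have hneg := neg_one_units_ne_one (R := R) c hc2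
    obtain rfl := eq_two_of_isPGroup_units hp h.1 hneg
    by_cases hc0 : c = 0
    · subst hc0
      have := CharP.charP_to_charZero R
      exact Or.inl ⟨Or.inl rfl, isoCyclic_two_or_four h (units_pow_four_eq_one_of_charZero h)⟩
    rcases char_eq_of_isLocallyCyclicPGroup c h hc0 hc2 with rfl | ⟨q, hq, hqc⟩
    · exact Or.inl ⟨Or.inr rfl, isoCyclic_two_or_four h (units_pow_four_eq_one_of_char_four h)⟩
    · refine Or.inr (Or.inr ⟨q, hq, hqc, ?_⟩)
      by_cases hq3 : q = 3
      · subst hq3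
        exact Or.inl ⟨rfl, isoCyclic_units_of_char_three_or_six c hqc h⟩
      · refine Or.inr ?_
        have hlt : 3 < q := by
          have := hq.1.two_le
          obtain ⟨t, rfl⟩ := hq.odd
          omega
        exact ⟨hlt, isoCyclic_units_of_fermat c hq hlt hqc h⟩

end Classification

/-! ### Reduction to commutative rings. -/

section Noncommutative

/-- A ring with commutative unit group contains a commutative subring with the same units. -/
theorem exists_commRing_units_mulEquiv (R : Type u) [Ring R] [Nontrivial R]
    (hcomm : ∀ a b : Rˣ, a * b = b * a) (c : ℕ) [CharP R c] :
    ∃ (S : Type u) (_ : CommRing S), Nontrivial S ∧ CharP S c ∧ Nonempty (Sˣ ≃* Rˣ) := by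
  let S := Subring.closure (Set.range (Units.val : Rˣ → R))
  have : IsMulCommutative S := Subring.isMulCommutative_closure (by
    rintro _ ⟨a, rfl⟩ _ ⟨b, rfl⟩
    rw [← Units.val_mul, hcomm, Units.val_mul])
  let _ : CommRing S := { (inferInstance : Ring S) with mul_comm := mul_comm' }
  -- Inverses of units are units too, so every unit of `R` remains invertible in `S`.
  have hmem : ∀ u : Rˣ, (u : R) ∈ S := fun u => Subring.subset_closure ⟨u, rfl⟩
  refine ⟨S, inferInstance, inferInstance, ?_, ⟨MulEquiv.ofBijective
    (Units.map (S.subtype : S →* R)) ⟨Units.map_injective Subtype.val_injective, fun u => ?_⟩⟩⟩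
  · exact (RingHom.charP_iff S.subtype Subtype.val_injective c).2 inferInstance
  · exact ⟨⟨⟨u, hmem u⟩, ⟨(u⁻¹ : Rˣ), hmem u⁻¹⟩, Subtype.ext (by simp), Subtype.ext (by simp)⟩,
      Units.ext rfl⟩

theorem IsListedCyclic.of_mulEquiv {c : ℕ} {G H : Type*} [Group G] [Group H]
    (h : IsListedCyclic c G) (e : G ≃* H) : IsListedCyclic c H := by
  have key : ∀ n, IsoCyclic G n → IsoCyclic H n := fun n h => h.of_mulEquiv e
  rcases h with ⟨hc, h⟩ | ⟨hc, h⟩ | ⟨q, hq, hc, h⟩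
  · exact Or.inl ⟨hc, h.imp (key _) (key _)⟩
  · exact Or.inr (Or.inl ⟨hc, h.imp (key _) (Or.imp (key _) fun ⟨p, hp, h⟩ => ⟨p, hp, key _ h⟩)⟩)
  · exact Or.inr (Or.inr ⟨q, hq, hc, h.imp (And.imp_right (Or.imp (key _) (key _)))
      (And.imp_right (key _))⟩)

theorem isListedCyclic_of_units_mulEquiv (R : Type u) [Ring R] [Nontrivial R] (c : ℕ) [CharP R c]
    {G : Type*} [CommGroup G] [Nontrivial G] (e : Rˣ ≃* G) {p : ℕ} (hp : p.Prime)
    (h : IsLocallyCyclicPGroup p G) : IsListedCyclic c G := by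
  obtain ⟨S, _, _, _, ⟨f⟩⟩ := exists_commRing_units_mulEquiv R
    (fun a b => e.injective (by rw [map_mul, map_mul, mul_comm])) c
  have : Nontrivial Sˣ := (f.trans e).toEquiv.nontrivial
  exact (isListedCyclic_units c hp (h.of_mulEquiv (f.trans e).symm)).of_mulEquiv (f.trans e)

theorem exists_prime_of_not_isMulTorsionFree {G : Type*} [CommGroup G] (h : ¬ IsMulTorsionFree G) :
    ∃ p : ℕ, p.Prime ∧ ∃ x : G, x ^ p = 1 ∧ x ≠ 1 := by
  obtain ⟨a, ha1, ha⟩ := not_isMulTorsionFree_iff_isOfFinOrder.1 h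
  have hne : orderOf a ≠ 1 := fun h => ha1 (orderOf_eq_one_iff.1 h)
  have hp := Nat.minFac_prime hne
  refine ⟨_, hp, a ^ (orderOf a / (orderOf a).minFac), ?_, ?_⟩
  · rw [← pow_mul, Nat.div_mul_cancel (Nat.minFac_dvd _), pow_orderOf_eq_one]
  · rw [ne_eq, ← orderOf_dvd_iff_pow_eq_one]
    intro hd
    have h0 : 0 < orderOf a := ha.orderOf_pos
    exact absurd (Nat.le_of_dvd (Nat.div_pos (Nat.minFac_le h0) hp.pos) hd)
      (not_le.2 (Nat.div_lt_self h0 hp.one_lt))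

/-- In a torsion-free group `(-1) ^ 2 = 1` forces `-1 = 1`; any torsion supplies an element of prime
order. -/
theorem unitGroup_classification (R : Type u) [Ring R] [Nontrivial R] (c : ℕ) [CharP R c]
    {G : Type u} [CommGroup G] (e : Rˣ ≃* G) (hG : IsIndecomposable G) :
    IsListedCyclic c G ∨ (c = 2 ∧ IsMulTorsionFree G) := by
  by_cases h : IsMulTorsionFree G
  · refine Or.inr ⟨?_, h⟩
    by_contra hc
    obtain ⟨S, _, _, _, ⟨f⟩⟩ := exists_commRing_units_mulEquiv R
      (fun a b => e.injective (by rw [map_mul, map_mul, mul_comm])) c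
    refine neg_one_units_ne_one (R := S) c hc ((f.trans e).injective ?_)
    refine pow_left_injective (M := G) two_ne_zero ?_
    simp only
    rw [← map_pow, ← map_pow]
    simp
  · left
    obtain ⟨p, hp, x, hx, hx1⟩ := exists_prime_of_not_isMulTorsionFree h
    have : Nontrivial G := ⟨x, 1, hx1⟩
    exact isListedCyclic_of_units_mulEquiv R c e hp (hG.isLocallyCyclicPGroup hp hx hx1)

end Noncommutative

/-! ### Quasi-cyclic groups are not unit groups. -/

section QuasiCyclic

theorem isLocallyCyclicPGroup_quasiCyclic {p : ℕ} (hp : p.Prime) :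
    IsLocallyCyclicPGroup p (quasiCyclic p) := by
  have : NeZero p := ⟨hp.ne_zero⟩
  refine ⟨fun g => ?_, fun a b => ?_⟩
  · obtain ⟨n, hn⟩ := g.2
    exact ⟨n, Subtype.ext hn⟩
  · obtain ⟨m, hm⟩ := a.2
    obtain ⟨n, hn⟩ := b.2
    have hm' := rootsOfUnity_le_of_dvd (pow_dvd_pow p (Nat.le_add_right m n)) hm
    have hn' := rootsOfUnity_le_of_dvd (pow_dvd_pow p (Nat.le_add_left n m)) hn
    obtain ⟨c, hc⟩ := IsCyclic.exists_generator (α := rootsOfUnity (p ^ (m + n)) ℂ)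
    obtain ⟨i, hi⟩ := hc ⟨a, hm'⟩
    obtain ⟨j, hj⟩ := hc ⟨b, hn'⟩
    exact ⟨⟨c, m + n, c.2⟩, ⟨i, Subtype.ext (by simpa using congrArg Subtype.val hi)⟩,
      ⟨j, Subtype.ext (by simpa using congrArg Subtype.val hj)⟩⟩

theorem infinite_quasiCyclic {p : ℕ} (hp : p.Prime) : Infinite (quasiCyclic p) := by
  rw [← not_finite_iff_infinite]
  intro hfin
  -- A quasi-cyclic group of finite order `N` would contain `p ^ N > N` roots of unity.
  have : NeZero (p ^ Nat.card (quasiCyclic p)) := ⟨(pow_pos hp.pos _).ne'⟩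
  have hinj := Nat.card_le_card_of_injective
    (Subgroup.inclusion (show rootsOfUnity (p ^ Nat.card (quasiCyclic p)) ℂ ≤ quasiCyclic p from
      fun z hz => ⟨_, hz⟩)) (Subgroup.inclusion_injective _)
  rw [Complex.card_rootsOfUnity] at hinj
  exact absurd (Nat.lt_pow_self hp.one_lt) (not_lt.2 hinj)

theorem FuchsIndecomposable.IsoCyclic.finite {G : Type*} [Group G] {n : ℕ} (h : IsoCyclic G n)
    (hn : n ≠ 0) : Finite G := by
  obtain ⟨e⟩ := h
  have : NeZero n := ⟨hn⟩
  exact Finite.of_equiv _ e.symm.toEquiv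

theorem IsListedCyclic.finite {c : ℕ} {G : Type*} [Group G] (h : IsListedCyclic c G) :
    Finite G := by
  rcases h with ⟨-, h | h⟩ | ⟨-, h | h | ⟨p, hp, h⟩⟩ | ⟨q, hq, -, ⟨-, h | h⟩ | ⟨h3, h⟩⟩
  · exact h.finite (by norm_num)
  · exact h.finite (by norm_num)
  · exact h.finite (by norm_num)
  · exact h.finite (by norm_num)
  · exact h.finite hp.1.ne_zero
  · exact h.finite (by norm_num)
  · exact h.finite (by norm_num)
  · exact h.finite (by omega)

theorem isEmpty_units_mulEquiv_quasiCyclic {p : ℕ} (hp : p.Prime) (R : Type u) [Ring R] :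
    IsEmpty (Rˣ ≃* quasiCyclic p) := by
  refine ⟨fun e => ?_⟩
  have := infinite_quasiCyclic hp
  have : Nontrivial R := by
    by_contra hR
    rw [not_nontrivial_iff_subsingleton] at hR
    have : Finite Rˣ := inferInstance
    exact not_finite_iff_infinite.2 ‹Infinite _› (Finite.of_equiv _ e.toEquiv)
  exact not_finite_iff_infinite.2 ‹Infinite _› (isListedCyclic_of_units_mulEquiv R (ringChar R) e hp
    (isLocallyCyclicPGroup_quasiCyclic hp)).finite

end QuasiCyclic

/-! ### Rings realizing the listed groups. -/

section Examples

theorem hasCharAndUnits_of_generator {R : Type*} [CommRing R] {c n : ℕ} [CharP R c] {g : R}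
    (hg : IsUnit g) (hord : orderOf g = n) (h : ∀ a : R, IsUnit a → ∃ k : ℕ, g ^ k = a) :
    HasCharAndUnits R c (CyclicGroup n) := by
  obtain ⟨g, rfl⟩ := hg
  have hgen : ∀ u : Rˣ, u ∈ Subgroup.zpowers g := fun u => by
    obtain ⟨k, hk⟩ := h u u.isUnit
    exact ⟨k, Units.ext (by simpa using hk)⟩
  have : IsCyclic Rˣ := ⟨g, hgen⟩
  refine ⟨inferInstance, isoCyclic_of_isCyclic ?_⟩
  rw [← orderOf_eq_card_of_forall_mem_zpowers hgen, ← hord, orderOf_units]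

theorem hasCharAndUnits_int : HasCharAndUnits ℤ 0 (CyclicGroup 2) := by
  have : CharP ℤ 0 := CharP.ofCharZero ℤ
  refine hasCharAndUnits_of_generator (g := -1) (by simp) (by simp [orderOf_neg_one]) ?_
  intro a ha
  rcases Int.isUnit_iff.1 ha with rfl | rfl
  · exact ⟨0, rfl⟩
  · exact ⟨1, rfl⟩

theorem hasCharAndUnits_gaussianInt : HasCharAndUnits GaussianInt 0 (CyclicGroup 4) := by
  have : CharP GaussianInt 0 := CharP.ofCharZero GaussianInt
  refine hasCharAndUnits_of_generator (g := (⟨0, 1⟩ : GaussianInt))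
    (Zsqrtd.norm_eq_one_iff.1 (by decide)) ?_ ?_
  · exact orderOf_eq_prime_pow (p := 2) (n := 1) (by decide) (by decide)
  · rintro ⟨a, b⟩ hu
    have h := (Zsqrtd.norm_eq_one_iff' (by norm_num) _).2 hu
    simp only [Zsqrtd.norm_def] at h
    have ha : a ≤ 1 := by nlinarith [mul_self_nonneg b]
    have ha' : -1 ≤ a := by nlinarith [mul_self_nonneg b]
    have hb : b ≤ 1 := by nlinarith [mul_self_nonneg a]
    have hb' : -1 ≤ b := by nlinarith [mul_self_nonneg a]
    interval_cases a <;> interval_cases b <;> simp at h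
    · exact ⟨2, by decide⟩
    · exact ⟨3, by decide⟩
    · exact ⟨1, by decide⟩
    · exact ⟨0, by decide⟩

theorem hasCharAndUnits_field {F : Type*} [Field F] [Finite F] {p n : ℕ} [CharP F p]
    (h : Nat.card F = n + 1) : HasCharAndUnits F p (CyclicGroup n) := by
  refine ⟨inferInstance, isoCyclic_of_isCyclic ?_⟩
  have := Nat.card_eq_card_units_add_one (α := F)
  omega

theorem hasCharAndUnits_prod_zmod_two {R : Type*} [Ring R] {c n : ℕ} (hc : Odd c)
    (h : HasCharAndUnits R c (CyclicGroup n)) :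
    HasCharAndUnits (R × ZMod 2) (2 * c) (CyclicGroup n) := by
  obtain ⟨_, ⟨e⟩⟩ := h
  have hlcm : Nat.lcm c 2 = 2 * c := by
    rw [Nat.Coprime.lcm_eq_mul (Nat.coprime_two_right.2 hc), mul_comm]
  refine ⟨hlcm ▸ Nat.lcm.charP R (ZMod 2) c 2, ?_⟩
  exact ⟨MulEquiv.prodUnits.trans (MulEquiv.prodUnique.trans e)⟩

theorem hasCharAndUnits_zmod_four : HasCharAndUnits (ZMod 4) 4 (CyclicGroup 2) := by
  refine hasCharAndUnits_of_generator (g := (3 : ZMod 4)) (isUnit_iff_exists_inv.2 ⟨3, by decide⟩)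
    (orderOf_eq_prime (by decide) (by decide)) fun a ha => ?_
  have : ∀ a : ZMod 4, (∃ b, a * b = 1) → a = 3 ^ 0 ∨ a = 3 ^ 1 := by decide
  rcases this a (isUnit_iff_exists_inv.1 ha) with rfl | rfl
  exacts [⟨0, rfl⟩, ⟨1, rfl⟩]

theorem exists_mul_X_add {A : Type*} [CommRing A] (I : Ideal A[X]) (a : A[X] ⧸ I) :
    ∃ (b : A[X] ⧸ I) (r : A), a = b * Ideal.Quotient.mk I X + Ideal.Quotient.mk I (C r) := by
  obtain ⟨f, rfl⟩ := Ideal.Quotient.mk_surjective a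
  exact ⟨Ideal.Quotient.mk I f.divX, f.coeff 0, by rw [← map_mul, ← map_add, divX_mul_X_add]⟩

section TruncatedPolynomials

variable (n : ℕ)

local notation "Q" => (ZMod 2)[X] ⧸ Ideal.span {(X ^ n : (ZMod 2)[X])}

theorem mk_X_pow_eq_zero_iff (m : ℕ) :
    (Ideal.Quotient.mk (Ideal.span {(X ^ n : (ZMod 2)[X])}) X) ^ m = 0 ↔ n ≤ m := by
  rw [← map_pow, Ideal.Quotient.eq_zero_iff_mem, Ideal.mem_span_singleton,
    pow_dvd_pow_iff X_ne_zero not_isUnit_X]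

theorem nontrivial_truncatedPolynomials (hn : n ≠ 0) : Nontrivial Q := by
  refine ⟨1, 0, fun h => ?_⟩
  have := (mk_X_pow_eq_zero_iff n 0).1 (by rw [pow_zero, h])
  omega

theorem charP_truncatedPolynomials (hn : n ≠ 0) : CharP Q 2 := by
  have := nontrivial_truncatedPolynomials n hn
  exact charP_of_injective_algebraMap (algebraMap (ZMod 2) Q).injective 2

theorem exists_mul_X_add_zero_or_one (a : Q) :
    ∃ b, a = b * Ideal.Quotient.mk _ X ∨ a = b * Ideal.Quotient.mk _ X + 1 := by
  obtain ⟨b, r, h⟩ := exists_mul_X_add _ a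
  refine ⟨b, ?_⟩
  rcases (by decide : ∀ r : ZMod 2, r = 0 ∨ r = 1) r with rfl | rfl
  · left; simpa using h
  · right; simpa using h

theorem exists_eq_mul_X_add_one_of_isUnit (hn : n ≠ 0) {a : Q} (ha : IsUnit a) :
    ∃ b, a = b * Ideal.Quotient.mk _ X + 1 := by
  have := nontrivial_truncatedPolynomials n hn
  obtain ⟨b, h | h⟩ := exists_mul_X_add_zero_or_one n a
  · have h0 : a ^ n = 0 := by rw [h, mul_pow, (mk_X_pow_eq_zero_iff n n).2 le_rfl, mul_zero]
    exact absurd (h0 ▸ ha.pow n) not_isUnit_zero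
  · exact ⟨b, h⟩

end TruncatedPolynomials

theorem hasCharAndUnits_truncated_two :
    HasCharAndUnits ((ZMod 2)[X] ⧸ Ideal.span {(X ^ 2 : (ZMod 2)[X])}) 2 (CyclicGroup 2) := by
  have := charP_truncatedPolynomials 2 two_ne_zero
  have key := mk_X_pow_eq_zero_iff 2
  have rep := exists_mul_X_add_zero_or_one 2
  have unitRep := @exists_eq_mul_X_add_one_of_isUnit 2 two_ne_zero
  set x := Ideal.Quotient.mk (Ideal.span {(X ^ 2 : (ZMod 2)[X])}) X
  have h2 : (2 : (ZMod 2)[X] ⧸ Ideal.span {(X ^ 2 : (ZMod 2)[X])}) = 0 := by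
    exact_mod_cast CharP.cast_eq_zero _ 2
  have hx2 : x ^ 2 = 0 := (key 2).2 le_rfl
  have hx : x ≠ 0 := fun h => by
    have := (key 1).1 (by rw [h, pow_one]); omega
  refine hasCharAndUnits_of_generator (g := 1 + x)
    (isUnit_iff_exists_inv.2 ⟨1 - x, by linear_combination -hx2⟩)
    (orderOf_eq_prime (by linear_combination hx2 + x * h2) (by simpa using hx)) fun a ha => ?_
  obtain ⟨b, rfl⟩ := unitRep ha
  obtain ⟨c, rfl | rfl⟩ := rep b
  · exact ⟨0, by linear_combination -c * hx2⟩
  · exact ⟨1, by linear_combination -c * hx2⟩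

theorem hasCharAndUnits_truncated_three :
    HasCharAndUnits ((ZMod 2)[X] ⧸ Ideal.span {(X ^ 3 : (ZMod 2)[X])}) 2 (CyclicGroup 4) := by
  have := charP_truncatedPolynomials 3 three_ne_zero
  have key := mk_X_pow_eq_zero_iff 3
  have rep := exists_mul_X_add_zero_or_one 3
  have unitRep := @exists_eq_mul_X_add_one_of_isUnit 3 three_ne_zero
  set x := Ideal.Quotient.mk (Ideal.span {(X ^ 3 : (ZMod 2)[X])}) X
  have h2 : (2 : (ZMod 2)[X] ⧸ Ideal.span {(X ^ 3 : (ZMod 2)[X])}) = 0 := by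
    exact_mod_cast CharP.cast_eq_zero _ 2
  have hx3 : x ^ 3 = 0 := (key 3).2 le_rfl
  have hx2 : x ^ 2 ≠ 0 := fun h => by
    have := (key 2).1 h; omega
  have hord : orderOf (1 + x) = 2 ^ (1 + 1) := by
    refine orderOf_eq_prime_pow (fun h => hx2 ?_) ?_
    · linear_combination h - x * h2
    · linear_combination (4 + x) * hx3 + (2 * x + 3 * x ^ 2) * h2
  refine hasCharAndUnits_of_generator (g := 1 + x)
    (isUnit_iff_exists_inv.2 ⟨1 - x + x ^ 2, by linear_combination hx3⟩) hord fun a ha => ?_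
  obtain ⟨b, rfl⟩ := unitRep ha
  obtain ⟨c, rfl | rfl⟩ := rep b <;> obtain ⟨d, rfl | rfl⟩ := rep c
  · exact ⟨0, by linear_combination -d * hx3⟩
  · exact ⟨2, by linear_combination -d * hx3 + x * h2⟩
  · exact ⟨1, by linear_combination -d * hx3⟩
  · exact ⟨3, by linear_combination (1 - d) * hx3 + (x + x ^ 2) * h2⟩

/-- In a relation with coefficients `f` and `g`, the constant term makes `f.coeff 0` odd, while the
coefficient of `X ^ 2` makes it even. -/
theorem two_notMem_span :
    (2 : (ZMod 4)[X]) ∉ Ideal.span {(X ^ 2 - 2 : (ZMod 4)[X]), 2 * X} := by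
  rw [Ideal.mem_span_pair]
  rintro ⟨f, g, h⟩
  have h2 : (2 : (ZMod 4)[X]) = C 2 := (map_ofNat C 2).symm
  have h' : f * X ^ 2 - f * C 2 + C 2 * (g * X) = C 2 := by
    rw [← h2]; linear_combination h
  have h0 := congrArg (coeff · 0) h'
  have h1 := congrArg (coeff · 2) h'
  simp only [coeff_add, coeff_sub, mul_coeff_zero, coeff_C_zero, coeff_X_zero, coeff_mul_X_pow',
    coeff_mul_C, coeff_C_mul, mul_zero, add_zero] at h0 h1
  rw [show (2 : ℕ) = 1 + 1 from rfl, coeff_mul_X, coeff_C_succ] at h1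
  simp at h0 h1
  have key : ∀ a b c : ZMod 4, -(a * 2) = 2 → a - b * 2 + 2 * c = 0 → False := by decide
  exact key _ _ _ h0 h1

theorem hasCharAndUnits_eisenstein_quotient :
    HasCharAndUnits ((ZMod 4)[X] ⧸ Ideal.span {(X ^ 2 - 2 : (ZMod 4)[X]), 2 * X}) 4
      (CyclicGroup 4) := by
  have rep := exists_mul_X_add (Ideal.span {(X ^ 2 - 2 : (ZMod 4)[X]), 2 * X})
  have h2 : (2 : (ZMod 4)[X] ⧸ Ideal.span {(X ^ 2 - 2 : (ZMod 4)[X]), 2 * X}) ≠ 0 := by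
    intro h
    exact two_notMem_span (Ideal.Quotient.eq_zero_iff_mem.1 (by rw [map_ofNat]; exact h))
  have hx2 : (Ideal.Quotient.mk (Ideal.span {(X ^ 2 - 2 : (ZMod 4)[X]), 2 * X}) X) ^ 2 = 2 := by
    rw [← sub_eq_zero, ← map_pow, ← map_ofNat (Ideal.Quotient.mk _) 2, ← map_sub]
    exact Ideal.Quotient.eq_zero_iff_mem.2 (Ideal.subset_span (by simp))
  have h2x : 2 * (Ideal.Quotient.mk (Ideal.span {(X ^ 2 - 2 : (ZMod 4)[X]), 2 * X}) X) = 0 := by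
    rw [← map_ofNat (Ideal.Quotient.mk _) 2, ← map_mul]
    exact Ideal.Quotient.eq_zero_iff_mem.2 (Ideal.subset_span (by simp))
  set x := Ideal.Quotient.mk (Ideal.span {(X ^ 2 - 2 : (ZMod 4)[X]), 2 * X}) X
  have h4 : (4 : (ZMod 4)[X] ⧸ Ideal.span {(X ^ 2 - 2 : (ZMod 4)[X]), 2 * X}) = 0 := by
    linear_combination x * h2x - 2 * hx2
  have hchar : CharP ((ZMod 4)[X] ⧸ Ideal.span {(X ^ 2 - 2 : (ZMod 4)[X]), 2 * X}) 4 := by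
    obtain ⟨c, hc⟩ := CharP.exists ((ZMod 4)[X] ⧸ Ideal.span {(X ^ 2 - 2 : (ZMod 4)[X]), 2 * X})
    have hc4 : c ∣ 2 ^ 2 := (CharP.cast_eq_zero_iff _ c _).1 (by exact_mod_cast h4)
    have hc2 : ¬ c ∣ 2 := fun h => h2 (by exact_mod_cast (CharP.cast_eq_zero_iff _ c 2).2 h)
    obtain ⟨i, hi, rfl⟩ := (Nat.dvd_prime_pow Nat.prime_two).1 hc4
    interval_cases i
    · simp at hc2
    · simp at hc2
    · exact hc
  have hnt : Nontrivial ((ZMod 4)[X] ⧸ Ideal.span {(X ^ 2 - 2 : (ZMod 4)[X]), 2 * X}) := ⟨2, 0, h2⟩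
  have rep2 : ∀ a, ∃ b, a = b * x ∨ a = b * x + 1 ∨ a = b * x + 2 ∨ a = b * x + 3 := by
    intro a
    obtain ⟨b, r, h⟩ := rep a
    refine ⟨b, ?_⟩
    rcases (by decide : ∀ r : ZMod 4, r = 0 ∨ r = 1 ∨ r = 2 ∨ r = 3) r with rfl | rfl | rfl | rfl
    · left; simpa using h
    · right; left; simpa using h
    · right; right; left; simpa only [map_ofNat] using h
    · right; right; right; simpa only [map_ofNat] using h
  -- The ideal generated by `x` is `{0, 2, x, x + 2}`, because `x ^ 2 = 2` and `2 * x = 0`.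
  have mulx : ∀ b, b * x = 0 ∨ b * x = 2 ∨ b * x = x ∨ b * x = x + 2 := by
    intro b
    obtain ⟨d, h⟩ := rep2 b
    obtain ⟨e, h'⟩ := rep2 d
    have h2d : 2 * d = 0 ∨ 2 * d = 2 := by
      rcases h' with rfl | rfl | rfl | rfl
      · left; linear_combination e * h2x
      · right; linear_combination e * h2x
      · left; linear_combination e * h2x + h4
      · right; linear_combination e * h2x + h4
    rcases h with rfl | rfl | rfl | rfl <;> rcases h2d with h | h
    · left; linear_combination h + d * hx2
    · right; left; linear_combination h + d * hx2
    · right; right; left; linear_combination h + d * hx2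
    · right; right; right; linear_combination h + d * hx2
    · left; linear_combination h + d * hx2 + h2x
    · right; left; linear_combination h + d * hx2 + h2x
    · right; right; left; linear_combination h + d * hx2 + h2x
    · right; right; right; linear_combination h + d * hx2 + h2x
  have hnil : ∀ a : (ZMod 4)[X] ⧸ Ideal.span {(X ^ 2 - 2 : (ZMod 4)[X]), 2 * X}, a ^ 4 = 0 → ¬ IsUnit a := fun a h0 ha => not_isUnit_zero (h0 ▸ ha.pow 4)
  have hord : orderOf (1 + x) = 2 ^ (1 + 1) := by
    refine orderOf_eq_prime_pow (fun h => h2 ?_) ?_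
    · linear_combination h - hx2 - h2x
    · linear_combination (x ^ 2 + 2 + 4 * x + 6) * hx2 + 6 * h2x + 4 * h4
  refine hasCharAndUnits_of_generator (g := 1 + x) ?_ hord fun a ha => ?_
  · exact IsUnit.of_pow_eq_one (n := 4) (by simpa [hord] using pow_orderOf_eq_one (1 + x)) (by simp)
  · obtain ⟨b, h⟩ := rep2 a
    -- An even constant part gives an element with fourth power zero, an odd one a power of `1 + x`.
    rcases mulx b with hb | hb | hb | hb <;> rw [hb] at h <;> rcases h with rfl | rfl | rfl | rfl
    · exact absurd ha (hnil _ (by ring))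
    · exact ⟨0, by ring⟩
    · exact absurd ha (hnil _ (by linear_combination 4 * h4))
    · exact ⟨2, by linear_combination hx2 + h2x⟩
    · exact absurd ha (hnil _ (by linear_combination 4 * h4))
    · exact ⟨2, by linear_combination hx2 + h2x⟩
    · exact absurd ha (hnil _ (by linear_combination 64 * h4))
    · exact ⟨0, by linear_combination -h4⟩
    · exact absurd ha (hnil _ (by linear_combination (x ^ 2 + 2) * hx2 + h4))
    · exact ⟨1, by ring⟩
    · exact absurd ha (hnil _ (by
        linear_combination (x ^ 2 + 2) * hx2 + (5 + 8 * x + 6 * x ^ 2 + 2 * x ^ 3) * h4))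
    · exact ⟨3, by linear_combination (x + 3) * hx2 + 2 * h2x + h4⟩
    · exact absurd ha (hnil _ (by
        linear_combination (x ^ 2 + 2) * hx2 + (5 + 8 * x + 6 * x ^ 2 + 2 * x ^ 3) * h4))
    · exact ⟨3, by linear_combination (x + 3) * hx2 + 2 * h2x + h4⟩
    · exact absurd ha (hnil _ (by
        linear_combination (x ^ 2 + 2) * hx2 + (65 + 64 * x + 24 * x ^ 2 + 4 * x ^ 3) * h4))
    · exact ⟨1, by linear_combination -h4⟩

theorem hasCharAndUnits_galoisField {p k n : ℕ} [Fact p.Prime] (hk : k ≠ 0) (hn : p ^ k = n + 1) :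
    HasCharAndUnits (GaloisField p k) p (CyclicGroup n) := by
  have hcard := GaloisField.card p k hk
  have : Finite (GaloisField p k) := Nat.finite_of_card_ne_zero (by rw [hcard, hn]; omega)
  exact hasCharAndUnits_field (by rw [hcard, hn])

theorem hasCharAndUnits_zmod {p : ℕ} (hp : p.Prime) :
    HasCharAndUnits (ZMod p) p (CyclicGroup (p - 1)) := by
  have := Fact.mk hp
  exact hasCharAndUnits_field (by rw [Nat.card_zmod]; have := hp.pos; omega)

/-- Torsion-free commutative groups have the two unique products property. -/
theorem twoUniqueProds_of_isMulTorsionFree (G : Type*) [CommGroup G] [IsMulTorsionFree G] :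
    TwoUniqueProds G where
  uniqueMul_of_one_lt_card := by
    classical
    intro A B hAB
    -- The property concerns finitely many elements at a time, so it can be checked in the finitely
    -- generated subgroup they span.
    let H : Subgroup G := Subgroup.closure ((A ∪ B : Finset G) : Set G)
    have hFG : Group.FG H := Group.closure_finset_fg _
    have : Monoid.FG H := Group.fg_iff_monoid_fg.1 hFG
    have hA : ∀ a ∈ A, a ∈ H := fun a ha => Subgroup.subset_closure (by simp [ha])
    have hB : ∀ b ∈ B, b ∈ H := fun b hb => Subgroup.subset_closure (by simp [hb])
    have hcA : (A.subtype (· ∈ H)).card = A.card := by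
      rw [Finset.card_subtype, Finset.filter_true_of_mem hA]
    have hcB : (B.subtype (· ∈ H)).card = B.card := by
      rw [Finset.card_subtype, Finset.filter_true_of_mem hB]
    have hlift : ∀ p : H × H, UniqueMul (A.subtype (· ∈ H)) (B.subtype (· ∈ H)) p.1 p.2 →
        UniqueMul A B (p.1 : G) p.2 := by
      intro p h a b ha hb hab
      have := h (a := ⟨a, hA a ha⟩) (b := ⟨b, hB b hb⟩) (by simpa using ha) (by simpa using hb)
        (Subtype.ext hab)
      exact ⟨congrArg Subtype.val this.1, congrArg Subtype.val this.2⟩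
    obtain ⟨p, hp, q, hq, hne, hpu, hqu⟩ := TwoUniqueProds.uniqueMul_of_one_lt_card
      (A := A.subtype (· ∈ H)) (B := B.subtype (· ∈ H)) (by rwa [hcA, hcB])
    refine ⟨(p.1, p.2), by simpa using hp, (q.1, q.2), by simpa using hq, fun h => hne ?_,
      hlift p hpu, hlift q hqu⟩
    rw [Prod.mk.injEq] at h
    exact Prod.ext (Subtype.ext h.1) (Subtype.ext h.2)

/-- Units of a group algebra over a domain are supported in a single group element if the group has
the two unique products property. -/
theorem card_support_le_one_of_mul_eq_one {K G : Type*} [Ring K] [IsDomain K] [Group G]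
    [TwoUniqueProds G] {f g : MonoidAlgebra K G} (h : f * g = 1) :
    f.coeff.support.card * g.coeff.support.card ≤ 1 := by
  by_contra! hlt
  obtain ⟨p, hp, q, hq, hne, hpu, hqu⟩ := TwoUniqueProds.uniqueMul_of_one_lt_card hlt
  -- At a uniquely represented product the coefficient of `f * g = 1` is a product of two nonzero
  -- coefficients, so that product is 1. Two such pairs would share a product.
  have key : ∀ r ∈ f.coeff.support ×ˢ g.coeff.support,
      UniqueMul f.coeff.support g.coeff.support r.1 r.2 → r.1 * r.2 = 1 := by
    intro r hr hu
    have h1 := MonoidAlgebra.coeff_mul_mul_of_uniqueMul hu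
    rw [Finset.mem_product, Finsupp.mem_support_iff, Finsupp.mem_support_iff] at hr
    by_contra hr1
    rw [h, MonoidAlgebra.one_def, MonoidAlgebra.coeff_single, Finsupp.single_eq_of_ne hr1] at h1
    exact mul_ne_zero hr.1 hr.2 h1.symm
  have := hqu (Finset.mem_product.1 hp).1 (Finset.mem_product.1 hp).2
    (by rw [key p hp hpu, key q hq hqu])
  exact hne (Prod.ext this.1 this.2)

theorem hasCharAndUnits_monoidAlgebra (G : Type*) [CommGroup G] [IsMulTorsionFree G] :
    HasCharAndUnits (MonoidAlgebra (ZMod 2) G) 2 G := by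
  have : TwoUniqueProds G := twoUniqueProds_of_isMulTorsionFree G
  refine ⟨charP_of_injective_algebraMap (algebraMap (ZMod 2) _).injective 2, ⟨MulEquiv.symm ?_⟩⟩
  refine MulEquiv.ofBijective
    ((Units.map (MonoidAlgebra.of (ZMod 2) G)).comp toUnits.toMonoidHom) ⟨?_, fun u => ?_⟩
  · intro a b hab
    exact MonoidAlgebra.of_injective (congrArg Units.val hab)
  · have hle := card_support_le_one_of_mul_eq_one u.mul_inv
    have hpos : ∀ v : (MonoidAlgebra (ZMod 2) G)ˣ, 0 < v.val.coeff.support.card := by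
      intro v
      rw [Finset.card_pos, Finsupp.support_nonempty_iff]
      intro h0
      exact v.ne_zero (MonoidAlgebra.coeff_injective h0)
    have h1 : (u : MonoidAlgebra (ZMod 2) G).coeff.support.card = 1 :=
      le_antisymm ((Nat.le_mul_of_pos_right _ (hpos u⁻¹)).trans hle) (hpos u)
    obtain ⟨a, r, hr, hu⟩ := Finsupp.card_support_eq_one'.1 h1
    have hr1 : r = 1 := by
      exact (by decide : ∀ r : ZMod 2, r ≠ 0 → r = 1) r hr
    refine ⟨a, Units.ext (MonoidAlgebra.coeff_injective ?_)⟩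
    rw [hu, hr1]
    simp

end Examples

/-! ### Assembly of the theorem. -/

section Main

theorem FuchsIndecomposable.IsoCyclic.isIndecomposable_and_isUnitGroupInChar {R : Type} [Ring R] [Nontrivial R]
    {c n p k : ℕ} (h : HasCharAndUnits R c (CyclicGroup n)) (hp : p.Prime) (hn : n = p ^ k)
    {G : Type u} [Group G] (hG : IsoCyclic G n) :
    IsIndecomposable G ∧ IsUnitGroupInChar c G := by
  refine ⟨isIndecomposable_of_isoCyclic_prime_pow hp (hn ▸ hG), ?_⟩
  obtain ⟨_, ⟨e⟩⟩ := h
  obtain ⟨f⟩ := hG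
  -- The example rings live in `Type`, so they are lifted to the universe of `G`.
  exact ⟨ULift.{u} R, inferInstance, inferInstance, ULift.charP R c,
    ⟨(Units.mapEquiv ULift.ringEquiv.toMulEquiv).trans (e.trans f.symm)⟩⟩

theorem FuchsIndecomposable.IsUnitGroupInChar.isListedCyclic_or {c : ℕ} {G : Type u} [CommGroup G]
    (hG : IsIndecomposable G) (h : IsUnitGroupInChar c G) :
    IsListedCyclic c G ∨ (c = 2 ∧ IsMulTorsionFree G) := by
  obtain ⟨R, _, _, _, ⟨e⟩⟩ := h
  exact unitGroup_classification R c e hG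

/-- With `q` odd and at least 3 in this form, linear arithmetic separates the characteristics and
recovers `q` from `q` or `2 * q`. -/
theorem FuchsIndecomposable.IsFermatPrime.exists_eq_two_mul_add_three {q : ℕ}
    (hq : IsFermatPrime q) : ∃ t, q = 2 * t + 3 := by
  obtain ⟨t, ht⟩ := hq.odd
  have := hq.1.two_le
  exact ⟨t - 1, by omega⟩

theorem IsListedCyclic.of_char_zero_or_four {c : ℕ} (hc : c = 0 ∨ c = 4) {G : Type*} [Group G]
    (h : IsListedCyclic c G) : IsoCyclic G 2 ∨ IsoCyclic G 4 := by
  rcases h with ⟨-, h⟩ | ⟨hc', -⟩ | ⟨q, hq, hc', -⟩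
  · exact h
  · omega
  · obtain ⟨t, rfl⟩ := hq.exists_eq_two_mul_add_three
    omega

theorem IsListedCyclic.of_char_two {G : Type*} [Group G] (h : IsListedCyclic 2 G) :
    IsoCyclic G 2 ∨ IsoCyclic G 4 ∨ ∃ p, IsMersennePrime p ∧ IsoCyclic G p := by
  rcases h with ⟨hc, -⟩ | ⟨-, h⟩ | ⟨q, hq, hc, -⟩
  · omega
  · exact h
  · obtain ⟨t, rfl⟩ := hq.exists_eq_two_mul_add_three
    omega

theorem IsListedCyclic.of_fermat {c q : ℕ} (hq : IsFermatPrime q) (hc : c = q ∨ c = 2 * q)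
    {G : Type*} [Group G] (h : IsListedCyclic c G) :
    (q = 3 ∧ (IsoCyclic G 2 ∨ IsoCyclic G 8)) ∨ (3 < q ∧ IsoCyclic G (q - 1)) := by
  obtain ⟨t, ht⟩ := hq.exists_eq_two_mul_add_three
  rcases h with ⟨hc', -⟩ | ⟨hc', -⟩ | ⟨r, hr, hc', h⟩
  · omega
  · omega
  · obtain ⟨s, hs⟩ := hr.exists_eq_two_mul_add_three
    obtain rfl : q = r := by omega
    exact h

theorem isFermatPrime_three : IsFermatPrime 3 := ⟨Nat.prime_three, 0, rfl⟩

theorem char_eq_of_isIndecomposable_units (R : Type u) [Ring R] [Nontrivial R]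
    (hcomm : ∀ a b : Rˣ, a * b = b * a) (hR : IsIndecomposable Rˣ) :
    ringChar R = 0 ∨ ringChar R = 2 ∨ ringChar R = 4 ∨
      ∃ q : ℕ, IsFermatPrime q ∧ (ringChar R = q ∨ ringChar R = 2 * q) := by
  let _ : CommGroup Rˣ := { (inferInstance : Group Rˣ) with mul_comm := hcomm }
  rcases unitGroup_classification R (ringChar R) (G := Rˣ) (MulEquiv.refl _) hR with
    (⟨h | h, -⟩ | ⟨h, -⟩ | ⟨q, hq, h, -⟩) | ⟨h, -⟩
  · exact Or.inl h
  · exact Or.inr (Or.inr (Or.inl h))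
  · exact Or.inr (Or.inl h)
  · exact Or.inr (Or.inr (Or.inr ⟨q, hq, h⟩))
  · exact Or.inr (Or.inl h)

theorem hasCharAndUnits_galoisField_mersenne {k : ℕ} (hk : (mersenne k).Prime) :
    HasCharAndUnits (GaloisField 2 k) 2 (CyclicGroup (mersenne k)) :=
  hasCharAndUnits_galoisField (by rintro rfl; exact Nat.not_prime_zero hk) (succ_mersenne k).symm

theorem hasCharAndUnits_galoisField_nine : HasCharAndUnits (GaloisField 3 2) 3 (CyclicGroup 8) :=
  hasCharAndUnits_galoisField two_ne_zero rfl

theorem nontrivial_of_hasCharAndUnits {R : Type*} [Ring R] {c : ℕ} {G : Type*} [Group G]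
    (h : HasCharAndUnits R c G) (hc : c ≠ 1) : Nontrivial R := by
  have := h.1
  exact CharP.nontrivial_of_char_ne_one hc

theorem theoremA :
    -- possible characteristics
    (∀ (R : Type u) [Ring R] [Nontrivial R],
      (∀ a b : Rˣ, a * b = b * a) → IsIndecomposable Rˣ →
        ringChar R = 0 ∨ ringChar R = 2 ∨ ringChar R = 4 ∨
          ∃ q : ℕ, IsFermatPrime q ∧ (ringChar R = q ∨ ringChar R = 2 * q)) ∧
    -- the complete list, for each of these characteristics
    (∀ (G : Type u) [CommGroup G],
      (IsIndecomposable G ∧ IsUnitGroupInChar 0 G ↔ IsoCyclic G 2 ∨ IsoCyclic G 4) ∧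
      (IsIndecomposable G ∧ IsUnitGroupInChar 2 G ↔
        IsoCyclic G 1 ∨ IsoCyclic G 2 ∨ IsoCyclic G 4 ∨
          (∃ p : ℕ, IsMersennePrime p ∧ IsoCyclic G p) ∨
          (IsIndecomposable G ∧ IsMulTorsionFree G)) ∧
      (IsIndecomposable G ∧ IsUnitGroupInChar 4 G ↔ IsoCyclic G 2 ∨ IsoCyclic G 4) ∧
      (IsIndecomposable G ∧ IsUnitGroupInChar 3 G ↔ IsoCyclic G 2 ∨ IsoCyclic G 8) ∧
      (IsIndecomposable G ∧ IsUnitGroupInChar 6 G ↔ IsoCyclic G 2 ∨ IsoCyclic G 8) ∧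
      (∀ q : ℕ, IsFermatPrime q → 3 < q →
        (IsIndecomposable G ∧ IsUnitGroupInChar q G ↔ IsoCyclic G (q - 1)) ∧
        (IsIndecomposable G ∧ IsUnitGroupInChar (2 * q) G ↔ IsoCyclic G (q - 1)))) ∧
    -- the example of a ring for each entry of the list
    (HasCharAndUnits ℤ 0 (CyclicGroup 2) ∧
      HasCharAndUnits GaussianInt 0 (CyclicGroup 4) ∧
      HasCharAndUnits (ZMod 2) 2 (CyclicGroup 1) ∧
      HasCharAndUnits ((ZMod 2)[X] ⧸ Ideal.span {(X ^ 2 : (ZMod 2)[X])}) 2 (CyclicGroup 2) ∧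
      HasCharAndUnits ((ZMod 2)[X] ⧸ Ideal.span {(X ^ 3 : (ZMod 2)[X])}) 2 (CyclicGroup 4) ∧
      (∀ k : ℕ, (mersenne k).Prime →
        HasCharAndUnits (GaloisField 2 k) 2 (CyclicGroup (mersenne k))) ∧
      (∀ (G : Type u) [CommGroup G], IsIndecomposable G → IsMulTorsionFree G →
        HasCharAndUnits (MonoidAlgebra (ZMod 2) G) 2 G) ∧
      HasCharAndUnits (ZMod 4) 4 (CyclicGroup 2) ∧
      HasCharAndUnits ((ZMod 4)[X] ⧸ Ideal.span {(X ^ 2 - 2 : (ZMod 4)[X]), 2 * X}) 4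
        (CyclicGroup 4) ∧
      HasCharAndUnits (ZMod 3) 3 (CyclicGroup 2) ∧
      HasCharAndUnits (GaloisField 3 2) 3 (CyclicGroup 8) ∧
      HasCharAndUnits (ZMod 3 × ZMod 2) 6 (CyclicGroup 2) ∧
      HasCharAndUnits (GaloisField 3 2 × ZMod 2) 6 (CyclicGroup 8) ∧
      (∀ q : ℕ, IsFermatPrime q → 3 < q →
        HasCharAndUnits (ZMod q) q (CyclicGroup (q - 1)) ∧
        HasCharAndUnits (ZMod q × ZMod 2) (2 * q) (CyclicGroup (q - 1)))) ∧
    -- no quasi-cyclic group is a group of units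
    (∀ p : ℕ, p.Prime → ∀ (R : Type u) [Ring R], IsEmpty (Rˣ ≃* quasiCyclic p)) := by
  have hF2 : HasCharAndUnits (ZMod 2) 2 (CyclicGroup 1) := hasCharAndUnits_zmod Nat.prime_two
  have hF3 : HasCharAndUnits (ZMod 3) 3 (CyclicGroup 2) := hasCharAndUnits_zmod Nat.prime_three
  have hF6 : HasCharAndUnits (ZMod 3 × ZMod 2) 6 (CyclicGroup 2) :=
    hasCharAndUnits_prod_zmod_two (by decide) hF3
  have hF9 := hasCharAndUnits_galoisField_nine
  have hF18 : HasCharAndUnits (GaloisField 3 2 × ZMod 2) 6 (CyclicGroup 8) :=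
    hasCharAndUnits_prod_zmod_two (by decide) hF9
  refine ⟨char_eq_of_isIndecomposable_units, fun G _ => ⟨?_, ?_, ?_, ?_, ?_, fun q hq hq3 => ?_⟩,
    ⟨hasCharAndUnits_int, hasCharAndUnits_gaussianInt, hF2, hasCharAndUnits_truncated_two,
      hasCharAndUnits_truncated_three, fun k hk => hasCharAndUnits_galoisField_mersenne hk,
      fun G _ _ _ => hasCharAndUnits_monoidAlgebra G, hasCharAndUnits_zmod_four,
      hasCharAndUnits_eisenstein_quotient, hF3, hF9, hF6, hF18, fun q hq _ =>
      ⟨hasCharAndUnits_zmod hq.1, hasCharAndUnits_prod_zmod_two hq.odd (hasCharAndUnits_zmod hq.1)⟩⟩,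
    fun p hp R _ => isEmpty_units_mulEquiv_quasiCyclic hp R⟩
  · refine ⟨fun ⟨hG, h⟩ => ?_, ?_⟩
    · exact ((h.isListedCyclic_or hG).resolve_right (by simp)).of_char_zero_or_four (by simp)
    · rintro (h | h)
      · exact h.isIndecomposable_and_isUnitGroupInChar hasCharAndUnits_int Nat.prime_two
          (k := 1) rfl
      · exact h.isIndecomposable_and_isUnitGroupInChar hasCharAndUnits_gaussianInt Nat.prime_two
          (k := 2) rfl
  · refine ⟨fun ⟨hG, h⟩ => ?_, ?_⟩
    · rcases h.isListedCyclic_or hG with h | ⟨-, h⟩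
      · rcases h.of_char_two with h | h | h
        · exact Or.inr (Or.inl h)
        · exact Or.inr (Or.inr (Or.inl h))
        · exact Or.inr (Or.inr (Or.inr (Or.inl h)))
      · exact Or.inr (Or.inr (Or.inr (Or.inr ⟨hG, h⟩)))
    · rintro (h | h | h | ⟨p, ⟨hp, k, rfl⟩, h⟩ | ⟨hG, h⟩)
      · exact h.isIndecomposable_and_isUnitGroupInChar hF2 Nat.prime_two (k := 0) rfl
      · have := nontrivial_of_hasCharAndUnits hasCharAndUnits_truncated_two (by simp)
        exact h.isIndecomposable_and_isUnitGroupInChar hasCharAndUnits_truncated_two Nat.prime_two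
          (k := 1) rfl
      · have := nontrivial_of_hasCharAndUnits hasCharAndUnits_truncated_three (by simp)
        exact h.isIndecomposable_and_isUnitGroupInChar hasCharAndUnits_truncated_three Nat.prime_two
          (k := 2) rfl
      · exact h.isIndecomposable_and_isUnitGroupInChar (hasCharAndUnits_galoisField_mersenne hp) hp
          (pow_one _).symm
      · exact ⟨hG, MonoidAlgebra (ZMod 2) G, inferInstance, inferInstance,
          hasCharAndUnits_monoidAlgebra G⟩
  · refine ⟨fun ⟨hG, h⟩ => ?_, ?_⟩
    · exact ((h.isListedCyclic_or hG).resolve_right (by simp)).of_char_zero_or_four (by simp)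
    · rintro (h | h)
      · have := nontrivial_of_hasCharAndUnits hasCharAndUnits_zmod_four (by simp)
        exact h.isIndecomposable_and_isUnitGroupInChar hasCharAndUnits_zmod_four Nat.prime_two
          (k := 1) rfl
      · have := nontrivial_of_hasCharAndUnits hasCharAndUnits_eisenstein_quotient (by simp)
        exact h.isIndecomposable_and_isUnitGroupInChar hasCharAndUnits_eisenstein_quotient
          Nat.prime_two (k := 2) rfl
  · refine ⟨fun ⟨hG, h⟩ => ?_, ?_⟩
    · exact ((((h.isListedCyclic_or hG).resolve_right (by simp)).of_fermat isFermatPrime_three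
        (by simp)).resolve_right (by simp)).2
    · rintro (h | h)
      · exact h.isIndecomposable_and_isUnitGroupInChar hF3 Nat.prime_two (k := 1) rfl
      · exact h.isIndecomposable_and_isUnitGroupInChar hF9 Nat.prime_two (k := 3) rfl
  · refine ⟨fun ⟨hG, h⟩ => ?_, ?_⟩
    · exact ((((h.isListedCyclic_or hG).resolve_right (by simp)).of_fermat isFermatPrime_three
        (by simp)).resolve_right (by simp)).2
    · rintro (h | h)
      · exact h.isIndecomposable_and_isUnitGroupInChar hF6 Nat.prime_two (k := 1) rfl
      · exact h.isIndecomposable_and_isUnitGroupInChar hF18 Nat.prime_two (k := 3) rfl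
  · obtain ⟨j, -, hj⟩ := hq.exists_eq
    have hj' : q - 1 = 2 ^ j := by omega
    have := Fact.mk hq.1
    have hZ := hasCharAndUnits_zmod hq.1
    constructor <;> refine ⟨fun ⟨hG, h⟩ => ?_, fun h => ?_⟩
    · exact ((((h.isListedCyclic_or hG).resolve_right (by omega)).of_fermat hq
        (by simp)).resolve_left (by omega)).2
    · exact h.isIndecomposable_and_isUnitGroupInChar hZ Nat.prime_two hj'
    · exact ((((h.isListedCyclic_or hG).resolve_right (by omega)).of_fermat hq
        (by simp)).resolve_left (by omega)).2
    · exact h.isIndecomposable_and_isUnitGroupInChar (hasCharAndUnits_prod_zmod_two hq.odd hZ)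
        Nat.prime_two hj'

end Main
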